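/- Let $K$ be an arbitrary field. **Jacobson blocks.** For a monic irreducible $p=s^n+a_{n-1}s^{n-1}+\dots+a_0\in K[s]$ let $C(p)$ be the companion matrix with ones on the superdiagonal and last row $(-a_0,\dots,-a_{n-1})$, and for $k\ge 0$ let $J(p^k)=I_k\otimes C(p)+N_k\otimes e_ne_1^T\in K^{nk\times nk}$, where $N_k$ is the $k\times k$ matrix with ones on the superdiagonal and zeros elsewhere. The Jacobson normal form of $A\in K^{\ell\times\ell}$ is $\operatorname{diag}(J(p_i^{k_i}))$, where the $p_i^{k_i}$ ($k_i\geq 1$) are the elementary divisors of $A$ over $K$, listed with multiplicity (i.e. the prime powers in the factorizations of the diagonal entries of the Smith form of $sI-A$); it is understood up to the order of the blocks. **Strictly proper part.** For $f\in K(s)$ let $\pi_-f$ be the strictly proper rational function for which $f-\pi_-f\in K[s]$; $\pi_-$ acts entrywise on matrices. **Realization procedure.** Let $T$ be a matrix of strictly proper rational functions over $K$. 1. Let $p_1^{e_1}\cdots p_m^{e_m}$ ($p_\mu$ distinct, monic, irreducible, $e_\mu\ge1$) be the monic least common denominator of the entries of $T$. Decompose $T=\sum_{\mu=1}^m T_{p_\mu}$,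 where the entries of $T_{p_\mu}$ are strictly proper and have only powers of $p_\mu$ as denominators. 2. For each $p=p_\mu$ choose a Smith–McMillan decomposition $T_{p}=U\Sigma V^T$ with $U=(u_1,u_2,\dots)$ and $V=(v_1,v_2,\dots)$ square and unimodular over $K[s]$, $\Sigma=\operatorname{diag}(a_1/p^{k_1},\dots,a_r/p^{k_r},0,\dots,0)$, $k_1\ge\dots\ge k_r\ge0$, $\gcd(p,a_i)=1$, $a_1\mid\dots\mid a_r$. Let $\tilde a_i\in K[s]$ be given by $\pi_-(a_ip^{-k_i})=\tilde a_ip^{-k_i}$. 3. For each $\mu$ and $i$ put $p=p_\mu$, $n=\deg p$, $k=k_i$, $h=u_i\tilde a_i$, $g=v_i$, and take the $p$-adic expansions $h=\sum_{j\ge0} h_jp^j$, $g=\sum_{j\ge0} g_jp^j$, where all entries of $h_j$ and $g_j$ have degree less than $n$. Define matrices $H_j$, $G_j$ over $K$ with $n$ columns by $h_j=H_j(1,s,\dots,s^{n-1})^T$ and $g_j=G_jM(1,s,\dots,s^{n-1})^T$, where $M$ is the $n\times n$ matrix whose $(i,j)$ entry ($1\le i,j\le n$) is the coefficient of $s^{i+j-1}$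 in $p$. Set $H^{(\mu,i)}=(H_0,\dots,H_{k-1})$, $\ G^{(\mu,i)}=\begin{pmatrix}G_{k-1}^T\\ \vdots\\ G_0^T\end{pmatrix}$, $\ F^{(\mu,i)}=J(p^k)$ (these are empty if $k=0$). 4. Let $F$ be the block diagonal matrix of all the $F^{(\mu,i)}$, let $H$ be the matrix of all the $H^{(\mu,i)}$ side by side, and let $G$ be the matrix of all the $G^{(\mu,i)}$ on top of each other, in the same order. **Theorem.** Let $A\in K^{\ell\times\ell}$. The realization procedure can be carried out for the resolvent $T(s)=(sI-A)^{-1}$, and whatever choices are made in it, the resulting matrices $F,G,H$ over $K$ satisfy the following. They are of size $\ell\times\ell$, $$(sI-A)^{-1}=H\,(sI-F)^{-1}\,G\qquad\text{and}\qquad G=H^{-1}.$$ Hence $A=HFH^{-1}$ and $H^{-1}AH=F$, and $F$ is the Jacobson normal form of $A$; that is, $H$ transforms $A$ into Jacobson normal form. -/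

import Mathlib

open scoped Kronecker

noncomputable section

namespace JacobsonRealization

variable {K : Type*} [Field K]

/-! ### Jacobson blocks -/

/-- The companion matrix of `p`: ones on the superdiagonal and last row
`(-a₀, -a₁, …, -a_{n-1})`, where `n = deg p`. -/
def companion (p : Polynomial K) : Matrix (Fin p.natDegree) (Fin p.natDegree) K :=
  Matrix.of fun i j =>
    if (i : ℕ) + 1 = p.natDegree then - p.coeff j
    else if (i : ℕ) + 1 = j then 1 else 0

/-- The `n × n` matrix `e_n e_1ᵀ`, whose only nonzero entry is a `1` in the lower left corner. -/
def cornerMatrix (K : Type*) [Field K] (n : ℕ) : Matrix (Fin n) (Fin n) K :=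
  Matrix.of fun i j => if (i : ℕ) + 1 = n ∧ (j : ℕ) = 0 then 1 else 0

/-- The `k × k` nilpotent matrix with ones on the superdiagonal. -/
def shiftMatrix (K : Type*) [Field K] (k : ℕ) : Matrix (Fin k) (Fin k) K :=
  Matrix.of fun i j => if (i : ℕ) + 1 = j then 1 else 0

/-- The Jacobson block `J(p^k)`: `k` companion blocks on the diagonal and copies of `e_n e_1ᵀ`
on the block superdiagonal. -/
def jacobsonBlock (p : Polynomial K) (k : ℕ) :
    Matrix (Fin k × Fin p.natDegree) (Fin k × Fin p.natDegree) K :=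
  (1 : Matrix (Fin k) (Fin k) K) ⊗ₖ companion p
    + shiftMatrix K k ⊗ₖ cornerMatrix K p.natDegree

/-- `diag (J(p_i^{k_i}))`, the block diagonal matrix of Jacobson blocks. -/
def jacobsonDiag {ι : Type*} [DecidableEq ι] (p : ι → Polynomial K) (k : ι → ℕ) :
    Matrix (Σ i, Fin (k i) × Fin (p i).natDegree) (Σ i, Fin (k i) × Fin (p i).natDegree) K :=
  Matrix.blockDiagonal' fun i => jacobsonBlock (p i) (k i)

/-! ### Elementary divisors and the Jacobson normal form -/

open Classical in
/-- The prime powers `q ^ e` (`q` monic irreducible, `e ≥ 1`) exactly dividing `f ≠ 0`. -/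
def primePowerFactors (f : Polynomial K) : Multiset (Polynomial K) :=
  (UniqueFactorizationMonoid.normalizedFactors f).toFinset.val.map
    fun q => q ^ (UniqueFactorizationMonoid.normalizedFactors f).count q

/-- `E` is the multiset of elementary divisors of `A` over `K`: the prime powers in the
factorizations of the invariant polynomials, i.e. of the diagonal entries `d` of the Smith form
of `sI - A`. -/
def IsElementaryDivisors {ℓ : ℕ} (A : Matrix (Fin ℓ) (Fin ℓ) K)
    (E : Multiset (Polynomial K)) : Prop :=
  ∃ (d : Fin ℓ → Polynomial K) (U V : Matrix (Fin ℓ) (Fin ℓ) (Polynomial K)),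
    IsUnit U.det ∧ IsUnit V.det ∧ A.charmatrix = U * Matrix.diagonal d * V ∧
    (∀ i, (d i).Monic) ∧ (∀ i j, i ≤ j → d i ∣ d j) ∧
    E = ∑ i, primePowerFactors (d i)

/-- `diag (J(p_i^{k_i}))` is the Jacobson normal form of `A`, up to the order of the blocks:
the `p_i` are monic and irreducible and the `p_i^{k_i}` are exactly the elementary divisors of `A`,
with multiplicities. An index with `k_i = 0` stands for an empty block, and is disregarded. -/
def IsJacobsonNormalForm {ℓ : ℕ} (A : Matrix (Fin ℓ) (Fin ℓ) K)
    {ι : Type*} [Fintype ι] (p : ι → Polynomial K) (k : ι → ℕ) : Prop :=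
  (∀ i, (p i).Monic ∧ Irreducible (p i)) ∧
  IsElementaryDivisors A
    ((Finset.univ.filter fun i => 0 < k i).val.map fun i => p i ^ k i)

/-! ### Rational functions -/

/-- A polynomial regarded as a rational function. -/
abbrev toRat (f : Polynomial K) : RatFunc K := algebraMap (Polynomial K) (RatFunc K) f

def IsStrictlyProper (f : RatFunc K) : Prop :=
  ∃ g h : Polynomial K, h ≠ 0 ∧ g.degree < h.degree ∧ f = toRat g / toRat h

/-- `w = π₋ f`: `f = w + y` with `w` strictly proper and `y` a polynomial. -/
def IsStrictlyProperPart (f w : RatFunc K) : Prop :=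
  IsStrictlyProper w ∧ ∃ y : Polynomial K, f = w + toRat y

/-- The matrix `(sI - A)⁻¹` over `K(s)`. -/
def matResolvent {n : Type*} [Fintype n] [DecidableEq n] (A : Matrix n n K) :
    Matrix n n (RatFunc K) :=
  (Matrix.scalar n (RatFunc.X : RatFunc K) - A.map RatFunc.C)⁻¹

/-- `d` is the monic least common denominator of the entries of `T`. -/
def IsLeastCommonDenominator {q t : ℕ} (T : Matrix (Fin q) (Fin t) (RatFunc K))
    (d : Polynomial K) : Prop :=
  d.Monic ∧ (∀ i j, (T i j).denom ∣ d) ∧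
    ∀ d' : Polynomial K, (∀ i j, (T i j).denom ∣ d') → d ∣ d'

/-! ### Realization of `π₋ (h p⁻ᵏ gᵀ)` with a single Jacobson block -/

/-- The symmetric matrix `M(p)` with rows `(a₁, …, a_{n-1}, 1)`, `(a₂, …, a_{n-1}, 1, 0)`, …,
`(1, 0, …, 0)`; it is invertible for monic `p`. -/
def hankelMatrix (p : Polynomial K) : Matrix (Fin p.natDegree) (Fin p.natDegree) K :=
  Matrix.of fun i j => p.coeff (i + j + 1)

/-- The coefficient `f_j` of the `p`-adic expansion `f = f₀ + f₁ p + f₂ p² + ⋯`,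
`deg f_j < deg p`, for monic `p`. -/
def padicDigit (p : Polynomial K) (j : ℕ) (f : Polynomial K) : Polynomial K :=
  (f /ₘ p ^ j) %ₘ p

/-- The matrix of coefficients of the polynomial vector `h_j`: `h_j = H_j (1, s, …, s^{n-1})ᵀ`. -/
def digitMatrix {q : ℕ} (p : Polynomial K) (j : ℕ) (h : Fin q → Polynomial K) :
    Matrix (Fin q) (Fin p.natDegree) K :=
  Matrix.of fun i c => (padicDigit p j (h i)).coeff c

/-- `H = (H₀, …, H_{k-1})`. -/
def blockH {q : ℕ} (p : Polynomial K) (k : ℕ) (h : Fin q → Polynomial K) :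
    Matrix (Fin q) (Fin k × Fin p.natDegree) K :=
  Matrix.of fun i x => digitMatrix p x.1 h i x.2

/-- `G = (G_{k-1}, …, G₀)ᵀ`, where `g_j = G_j M (1, s, …, s^{n-1})ᵀ`. -/
def blockG {t : ℕ} (p : Polynomial K) (k : ℕ) (g : Fin t → Polynomial K) :
    Matrix (Fin k × Fin p.natDegree) (Fin t) K :=
  Matrix.of fun x i => (digitMatrix p (x.1.rev : ℕ) g * (hankelMatrix p)⁻¹) i x.2

/-! ### The realization procedure -/

/-- A Smith-McMillan decomposition `T = U Σ Vᵀ` of a matrix whose entries have powers of `p` as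
denominators, with `Σ = diag(a₁/p^{k₁}, …, a_r/p^{k_r}, 0, …, 0)`, `k₁ ≥ ⋯ ≥ k_r ≥ 0`,
`gcd(p, a_i) = 1` and `a₁ ∣ ⋯ ∣ a_r`. -/
structure SmithMcMillan {q t : ℕ} (p : Polynomial K) (T : Matrix (Fin q) (Fin t) (RatFunc K)) where
  r : ℕ
  r_le_rows : r ≤ q
  r_le_cols : r ≤ t
  a : Fin r → Polynomial K
  k : Fin r → ℕ
  U : Matrix (Fin q) (Fin q) (Polynomial K)
  V : Matrix (Fin t) (Fin t) (Polynomial K)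
  k_antitone : Antitone k
  coprime : ∀ i, IsCoprime p (a i)
  dvd_chain : ∀ i j, i ≤ j → a i ∣ a j
  unimodular_U : IsUnit U.det
  unimodular_V : IsUnit V.det
  factorization : T = U.map toRat *
    (Matrix.of fun (i : Fin q) (j : Fin t) =>
      if h : (i : ℕ) = j ∧ (i : ℕ) < r then toRat (a ⟨i, h.2⟩) / toRat (p ^ k ⟨i, h.2⟩) else 0) *
    (V.map toRat).transpose

/-- The column `u_i` of `U` belonging to the `i`-th diagonal entry. -/
def SmithMcMillan.u {q t : ℕ} {p : Polynomial K} {T : Matrix (Fin q) (Fin t) (RatFunc K)}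
    (S : SmithMcMillan p T) (i : Fin S.r) : Fin q → Polynomial K :=
  fun x => S.U x (Fin.castLE S.r_le_rows i)

/-- The column `v_i` of `V` belonging to the `i`-th diagonal entry. -/
def SmithMcMillan.v {q t : ℕ} {p : Polynomial K} {T : Matrix (Fin q) (Fin t) (RatFunc K)}
    (S : SmithMcMillan p T) (i : Fin S.r) : Fin t → Polynomial K :=
  fun x => S.V x (Fin.castLE S.r_le_cols i)

/-- One run of the realization procedure on a strictly proper matrix `T`, i.e. all choices made
in it: the prime factorization `∏ p_μ^{e_μ}` of the monic least common denominator, the partial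
fraction decomposition `T = ∑ T_{p_μ}`, a Smith-McMillan decomposition of every `T_{p_μ}`, and the
polynomials `ã_i` with `π₋(a_i p^{-k_i}) = ã_i p^{-k_i}`. The matrices `F`, `G`, `H` are computed
from these data below. -/
structure Procedure {q t : ℕ} (T : Matrix (Fin q) (Fin t) (RatFunc K)) where
  m : ℕ
  p : Fin m → Polynomial K
  e : Fin m → ℕ
  p_monic : ∀ μ, (p μ).Monic
  p_irreducible : ∀ μ, Irreducible (p μ)
  p_injective : Function.Injective p
  e_pos : ∀ μ, 0 < e μ
  lcd : IsLeastCommonDenominator T (∏ μ, p μ ^ e μ)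
  part : Fin m → Matrix (Fin q) (Fin t) (RatFunc K)
  part_sum : T = ∑ μ, part μ
  part_proper : ∀ μ i j, IsStrictlyProper (part μ i j)
  part_denom : ∀ μ i j, ∃ N : ℕ, (part μ i j).denom ∣ p μ ^ N
  smith : ∀ μ, SmithMcMillan (p μ) (part μ)
  atilde : ∀ μ, Fin (smith μ).r → Polynomial K
  atilde_spec : ∀ μ i, IsStrictlyProperPart
    (toRat ((smith μ).a i) / toRat (p μ ^ (smith μ).k i))
    (toRat (atilde μ i) / toRat (p μ ^ (smith μ).k i))

namespace Procedure

variable {q t : ℕ} {T : Matrix (Fin q) (Fin t) (RatFunc K)} (P : Procedure T)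

/-- The indices `(μ, i)` of the rank one summands `w = (u_i ã_i) p_μ^{-k_i} v_iᵀ`. Those with
`k_i = 0` have `π₋ w = 0`, and contribute blocks of size zero. -/
abbrev Block : Type := Σ μ : Fin P.m, Fin (P.smith μ).r

/-- The prime belonging to a summand. -/
def prime (x : P.Block) : Polynomial K := P.p x.1

/-- The exponent belonging to a summand. -/
def exponent (x : P.Block) : ℕ := (P.smith x.1).k x.2

/-- The index set of the state space. -/
abbrev State : Type := Σ x : P.Block, Fin (P.exponent x) × Fin (P.prime x).natDegree

/-- The state transition matrix: the direct sum of the Jacobson blocks `J(p_μ^{k_i})`. -/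
def F : Matrix P.State P.State K := jacobsonDiag P.prime P.exponent

/-- The matrices `H` of the rank one realizations (with `h = u_i ã_i`), side by side. -/
def H : Matrix (Fin q) P.State K :=
  Matrix.of fun i y =>
    blockH (P.prime y.1) (P.exponent y.1)
      (fun z => (P.smith y.1.1).u y.1.2 z * P.atilde y.1.1 y.1.2) i y.2

/-- The matrices `G` of the rank one realizations (with `g = v_i`), on top of each other. -/
def G : Matrix P.State (Fin t) K :=
  Matrix.of fun y j =>
    blockG (P.prime y.1) (P.exponent y.1) ((P.smith y.1.1).v y.1.2) y.2 j

end Procedure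

end JacobsonRealization

end

namespace JacobsonRealization

open Matrix Polynomial UniqueFactorizationMonoid

variable {K : Type*} [Field K]

/-! ### Strictly proper rational functions -/

/-! Modulo polynomials, one Jacobson block J = J(pᵏ) realizes the scalar f g / pᵏ. The vector with
entries pⁱ sᶜ satisfies (sI - J)(pⁱ sᶜ) = pᵏ e_last, which gives (sI - J)⁻¹ e_last. The map
`dualColumn` sends 1 to e_last and turns multiplication by s into J, so (sI - J)⁻¹ maps the dual
column of g to g (pⁱ sᶜ) / pᵏ up to polynomials; pairing with the digits of f yields f g / pᵏ. The
Hankel matrix enters because C(p) acts on digit rows from the right, while G consists of columns: it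
intertwines C(p) with its transpose. Summed over the rank one terms, this shows that T and H(sI -
F)⁻¹G differ by a polynomial matrix. Both are strictly proper, so they agree
(`Procedure.realization`).

The realization is minimal. Every state vector consists of digit rows, or dual columns, of suitable
polynomials f. If it is invisible to H or to G, then a combination of columns of unimodular matrices
with coefficients f / pᵏ (times ã on the H side) is polynomial. Partial fractions separate the
primes, unimodularity separates the columns, and coprimality removes ã; hence pᵏ divides f and the
vector is zero.

For the resolvent T of A this forces similarity. With R = (sI - F)⁻¹ one has (AH - HF)RG = HG - 1; a
strictly proper matrix equals a constant one, so both vanish, and controllability gives AH = HF.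
Then HR(GH - 1) = 0, and observability gives GH = 1.

That F is the normal form follows from the equivalence of sI - J(pᵏ) with diag(pᵏ, 1, …, 1). The
resulting diagonal form of sI - A becomes a divisibility chain by replacing pairs with their gcd and
lcm, which keeps the multiset of prime power factors.

A run exists because the least common denominator is the minimal polynomial and the parts can be
taken as ε(A)(sI - A)⁻¹ with ε(A) idempotent. Each part then has sI - A as a polynomial generalized
inverse, which makes its Smith–McMillan form unit numerators over powers of p. -/

theorem toRat_ne_zero {f : K[X]} (hf : f ≠ 0) : toRat f ≠ 0 := by
  simpa [toRat] using hf

theorem toRat_injective : Function.Injective (toRat : K[X] → RatFunc K) :=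
  RatFunc.algebraMap_injective K

theorem toRat_zero : toRat (0 : K[X]) = 0 := map_zero _

theorem toRat_one : toRat (1 : K[X]) = 1 := map_one _

theorem toRat_add (f g : K[X]) : toRat (f + g) = toRat f + toRat g := map_add _ _ _

theorem toRat_sub (f g : K[X]) : toRat (f - g) = toRat f - toRat g := map_sub _ _ _

theorem toRat_mul (f g : K[X]) : toRat (f * g) = toRat f * toRat g := map_mul _ _ _

theorem toRat_sum {ι : Type*} (s : Finset ι) (f : ι → K[X]) :
    toRat (∑ i ∈ s, f i) = ∑ i ∈ s, toRat (f i) := map_sum _ _ _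

theorem isStrictlyProper_zero : IsStrictlyProper (0 : RatFunc K) :=
  ⟨0, 1, one_ne_zero, by simp, by simp⟩

theorem IsStrictlyProper.add {f g : RatFunc K} (hf : IsStrictlyProper f)
    (hg : IsStrictlyProper g) : IsStrictlyProper (f + g) := by
  obtain ⟨a, b, hb, hab, rfl⟩ := hf
  obtain ⟨c, d, hd, hcd, rfl⟩ := hg
  refine ⟨a * d + b * c, b * d, mul_ne_zero hb hd, ?_, ?_⟩
  · refine (degree_add_le _ _).trans_lt (max_lt ?_ ?_)
    · rw [degree_mul, degree_mul]
      exact WithBot.add_lt_add_right (degree_ne_bot.2 hd) hab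
    · rw [degree_mul, degree_mul]
      exact WithBot.add_lt_add_left (degree_ne_bot.2 hb) hcd
  · have := toRat_ne_zero hb
    have := toRat_ne_zero hd
    rw [div_add_div _ _ (toRat_ne_zero hb) (toRat_ne_zero hd)]
    simp [toRat]

theorem IsStrictlyProper.const_mul {f : RatFunc K} (hf : IsStrictlyProper f) (c : K) :
    IsStrictlyProper (RatFunc.C c * f) := by
  obtain ⟨a, b, hb, hab, rfl⟩ := hf
  refine ⟨C c * a, b, hb, ?_, ?_⟩
  · rw [degree_mul]
    exact lt_of_le_of_lt (add_le_add degree_C_le le_rfl) (by rwa [zero_add])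
  · simp [toRat, mul_div_assoc]

theorem IsStrictlyProper.mul_const {f : RatFunc K} (hf : IsStrictlyProper f) (c : K) :
    IsStrictlyProper (f * RatFunc.C c) := by
  rw [mul_comm]; exact hf.const_mul c

theorem IsStrictlyProper.neg {f : RatFunc K} (hf : IsStrictlyProper f) :
    IsStrictlyProper (-f) := by
  simpa using hf.const_mul (-1)

theorem IsStrictlyProper.sub {f g : RatFunc K} (hf : IsStrictlyProper f)
    (hg : IsStrictlyProper g) : IsStrictlyProper (f - g) := by
  rw [sub_eq_add_neg]; exact hf.add hg.neg

theorem IsStrictlyProper.sum {ι : Type*} (s : Finset ι) {f : ι → RatFunc K}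
    (hf : ∀ i ∈ s, IsStrictlyProper (f i)) : IsStrictlyProper (∑ i ∈ s, f i) :=
  Finset.sum_induction f IsStrictlyProper (fun _ _ => IsStrictlyProper.add)
    isStrictlyProper_zero hf

/-- If f = a / b with deg a < deg b, then a = f b forces f = 0. This turns each equality modulo
polynomials of strictly proper functions into an equality. -/
theorem IsStrictlyProper.eq_zero_of_toRat {f : K[X]} (hf : IsStrictlyProper (toRat f)) :
    f = 0 := by
  obtain ⟨a, b, hb, hab, h⟩ := hf
  rw [eq_div_iff (toRat_ne_zero hb), ← map_mul] at h
  have h' := toRat_injective h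
  by_contra hf
  rw [← h', degree_mul] at hab
  have h1 : (0 : WithBot ℕ) ≤ f.degree := zero_le_degree_iff.2 hf
  have h2 : b.degree ≤ f.degree + b.degree := le_add_of_nonneg_left h1
  exact absurd hab (not_lt.2 h2)

theorem toRat_C (c : K) : toRat (C c) = RatFunc.C c := by simp [toRat]

theorem toRat_X : toRat (X : K[X]) = RatFunc.X := by simp [toRat]

/-- Constant linear combinations of strictly proper entries are strictly proper. -/
theorem isStrictlyProper_const_mul {l m n : Type*} [Fintype m] (A : Matrix l m K)
    {B : Matrix m n (RatFunc K)} (hB : ∀ i j, IsStrictlyProper (B i j)) (i : l) (j : n) :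
    IsStrictlyProper ((A.map RatFunc.C * B) i j) :=
  IsStrictlyProper.sum _ fun x _ => (hB x j).const_mul (A i x)

theorem isStrictlyProper_mul_const {l m n : Type*} [Fintype m] {A : Matrix l m (RatFunc K)}
    (B : Matrix m n K) (hA : ∀ i j, IsStrictlyProper (A i j)) (i : l) (j : n) :
    IsStrictlyProper ((A * B.map RatFunc.C) i j) :=
  IsStrictlyProper.sum _ fun x _ => (hA i x).mul_const (B x j)

/-! ### Resolvents -/

section Resolvent

variable {n : Type*} [Fintype n] [DecidableEq n]

theorem matResolvent_eq (A : Matrix n n K) :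
    matResolvent A = (A.charmatrix.map toRat)⁻¹ := by
  unfold matResolvent
  congr 1
  ext i j
  by_cases h : i = j
  · subst h; simp [toRat]
  · simp [toRat, h]

theorem charmatrix_map_toRat (A : Matrix n n K) :
    A.charmatrix.map toRat = Matrix.scalar n (RatFunc.X : RatFunc K) - A.map RatFunc.C := by
  ext i j
  by_cases h : i = j
  · subst h; simp [toRat]
  · simp [toRat, h]

theorem det_charmatrix_map_toRat (A : Matrix n n K) :
    (A.charmatrix.map toRat).det = toRat A.charpoly :=
  ((algebraMap K[X] (RatFunc K)).map_det A.charmatrix).symm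

theorem isUnit_det_charmatrix_map_toRat (A : Matrix n n K) :
    IsUnit (A.charmatrix.map toRat).det := by
  rw [det_charmatrix_map_toRat]
  exact (toRat_ne_zero A.charpoly_monic.ne_zero).isUnit

theorem charmatrix_mul_matResolvent (A : Matrix n n K) :
    A.charmatrix.map toRat * matResolvent A = 1 := by
  rw [matResolvent_eq, mul_nonsing_inv _ (isUnit_det_charmatrix_map_toRat A)]

theorem matResolvent_mul_charmatrix (A : Matrix n n K) :
    matResolvent A * A.charmatrix.map toRat = 1 := by
  rw [matResolvent_eq, nonsing_inv_mul _ (isUnit_det_charmatrix_map_toRat A)]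

theorem const_mul_matResolvent (A : Matrix n n K) :
    A.map RatFunc.C * matResolvent A = (RatFunc.X : RatFunc K) • matResolvent A - 1 := by
  have h := charmatrix_mul_matResolvent A
  rw [charmatrix_map_toRat, sub_mul, scalar_apply, ← smul_eq_diagonal_mul] at h
  rw [← h, sub_sub_cancel]

theorem matResolvent_mul_const (A : Matrix n n K) :
    matResolvent A * A.map RatFunc.C = (RatFunc.X : RatFunc K) • matResolvent A - 1 := by
  have h := matResolvent_mul_charmatrix A
  rw [charmatrix_map_toRat, mul_sub, scalar_apply] at h
  have h2 : matResolvent A * diagonal (fun _ => (RatFunc.X : RatFunc K))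
      = (RatFunc.X : RatFunc K) • matResolvent A := by
    ext i j; simp [mul_diagonal, mul_comm]
  rw [h2] at h
  rw [← h, sub_sub_cancel]

/-- An adjugate entry is the determinant of sI - A with one row replaced by a unit vector. As a
linear pencil it has a leading matrix with a zero row, so the top coefficient vanishes. -/
theorem degree_adjugate_charmatrix_lt (A : Matrix n n K) (i j : n) :
    (A.charmatrix.adjugate i j).degree < (Fintype.card n : ℕ) := by
  have h : A.charmatrix.updateRow j (Pi.single i 1)
      = (X : K[X]) • ((1 : Matrix n n K).updateRow j 0).map C
        + ((-A).updateRow j (Pi.single i 1)).map C := by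
    refine Matrix.ext fun x y => ?_
    by_cases hx : x = j
    · subst hx
      by_cases hy : y = i
      · subst hy; simp
      · simp [hy]
    · by_cases hxy : x = y
      · subst hxy; simp [updateRow_ne hx, sub_eq_add_neg]
      · simp [updateRow_ne hx, hxy]
  rw [adjugate_apply, h]
  have h1 := natDegree_det_X_add_C_le ((1 : Matrix n n K).updateRow j 0)
    ((-A).updateRow j (Pi.single i 1))
  have h2 := coeff_det_X_add_C_card ((1 : Matrix n n K).updateRow j 0)
    ((-A).updateRow j (Pi.single i 1))
  have h3 : ((1 : Matrix n n K).updateRow j 0).det = 0 :=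
    det_eq_zero_of_row_eq_zero j fun x => by simp
  rw [h3] at h2
  rw [degree_lt_iff_coeff_zero]
  intro m hm
  rcases hm.eq_or_lt with rfl | hm
  · exact h2
  · exact coeff_eq_zero_of_natDegree_lt (h1.trans_lt hm)

theorem isStrictlyProper_matResolvent (A : Matrix n n K) (i j : n) :
    IsStrictlyProper (matResolvent A i j) := by
  refine ⟨A.charmatrix.adjugate i j, A.charpoly, A.charpoly_monic.ne_zero, ?_, ?_⟩
  · rw [charpoly_degree_eq_dim]
    exact degree_adjugate_charmatrix_lt A i j
  · rw [matResolvent_eq, Matrix.inv_def, det_charmatrix_map_toRat, Ring.inverse_eq_inv']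
    have : (A.charmatrix.map toRat).adjugate = A.charmatrix.adjugate.map toRat :=
      ((algebraMap K[X] (RatFunc K)).map_adjugate A.charmatrix).symm
    rw [this]
    simp [div_eq_inv_mul]

end Resolvent

/-! ### `p`-adic digits -/

section Digits

variable {p : K[X]}

/-- Uniqueness of division with remainder, applied twice. The digit computations below exhibit such
a decomposition. -/
theorem padicDigit_eq (hp : p.Monic) {j : ℕ} {g a d r : K[X]} (h : g = a + p ^ j * (d + p * r))
    (ha : a.degree < (p ^ j).degree) (hd : d.degree < p.degree) : padicDigit p j g = d := by
  unfold padicDigit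
  rw [(div_modByMonic_unique (d + p * r) a (hp.pow j) ⟨h.symm, ha⟩).1,
    (div_modByMonic_unique r d hp ⟨rfl, hd⟩).2]

theorem padicDigit_expansion (j : ℕ) (g : K[X]) :
    g = g %ₘ p ^ j + p ^ j * (padicDigit p j g + p * (g /ₘ p ^ j /ₘ p)) := by
  unfold padicDigit
  rw [modByMonic_add_div, modByMonic_add_div]

theorem degree_padicDigit_lt (hp : p.Monic) (j : ℕ) (g : K[X]) :
    (padicDigit p j g).degree < p.degree :=
  degree_modByMonic_lt _ hp

theorem padicDigit_add (hp : p.Monic) (j : ℕ) (f g : K[X]) :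
    padicDigit p j (f + g) = padicDigit p j f + padicDigit p j g := by
  have hf := padicDigit_expansion (p := p) j f
  have hg := padicDigit_expansion (p := p) j g
  refine padicDigit_eq hp (a := f %ₘ p ^ j + g %ₘ p ^ j)
    (r := f /ₘ p ^ j /ₘ p + g /ₘ p ^ j /ₘ p) ?_ ?_ ?_
  · linear_combination hf + hg
  · exact (degree_add_le _ _).trans_lt
      (max_lt (degree_modByMonic_lt _ (hp.pow j)) (degree_modByMonic_lt _ (hp.pow j)))
  · exact (degree_add_le _ _).trans_lt
      (max_lt (degree_padicDigit_lt hp j f) (degree_padicDigit_lt hp j g))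

theorem degree_C_mul_lt {c : K} {f : K[X]} {d : WithBot ℕ} (h : f.degree < d) :
    (C c * f).degree < d := by
  rw [degree_mul]
  exact lt_of_le_of_lt (add_le_add degree_C_le le_rfl) (by rwa [zero_add])

theorem padicDigit_C_mul (hp : p.Monic) (j : ℕ) (c : K) (f : K[X]) :
    padicDigit p j (C c * f) = C c * padicDigit p j f := by
  have hf := padicDigit_expansion (p := p) j f
  refine padicDigit_eq hp (a := C c * (f %ₘ p ^ j)) (r := C c * (f /ₘ p ^ j /ₘ p)) ?_ ?_ ?_
  · linear_combination C c * hf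
  · exact degree_C_mul_lt (degree_modByMonic_lt _ (hp.pow j))
  · exact degree_C_mul_lt (degree_padicDigit_lt hp j f)

theorem padicDigit_pow_mul_of_lt (hp : p.Monic) {j k : ℕ} (hjk : j < k)
    (f : K[X]) : padicDigit p j (p ^ k * f) = 0 := by
  obtain ⟨m, rfl⟩ := Nat.exists_eq_add_of_lt hjk
  refine padicDigit_eq hp (a := 0) (r := p ^ m * f) (by ring) ?_ ?_
  · rw [degree_zero]; exact bot_lt_iff_ne_bot.2 (degree_ne_bot.2 (hp.pow j).ne_zero)
  · rw [degree_zero]; exact bot_lt_iff_ne_bot.2 (degree_ne_bot.2 hp.ne_zero)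

theorem padicDigit_one (hp : p.Monic) (hn : 0 < p.natDegree) (j : ℕ) :
    padicDigit p j 1 = if j = 0 then 1 else 0 := by
  have h1 : (1 : K[X]).degree < p.degree := by
    rw [degree_one, degree_eq_natDegree hp.ne_zero]; exact_mod_cast hn
  split_ifs with hj
  · subst hj
    refine padicDigit_eq hp (a := 0) (r := 0) (by simp) ?_ h1
    simp
  · refine padicDigit_eq hp (a := 1) (r := 0) (by simp) ?_ ?_
    · rw [degree_one, degree_pow, degree_eq_natDegree hp.ne_zero]
      have : 0 < j * p.natDegree := Nat.mul_pos (Nat.pos_of_ne_zero hj) hn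
      rw [nsmul_eq_mul]; exact_mod_cast this
    · rw [degree_zero]; exact bot_lt_iff_ne_bot.2 (degree_ne_bot.2 hp.ne_zero)

theorem degree_X_mul_sub_lt (hp : p.Monic) (hn : 0 < p.natDegree) {d : K[X]}
    (hd : d.degree < p.degree) :
    (X * d - C (d.coeff (p.natDegree - 1)) * p).degree < p.degree := by
  rw [degree_eq_natDegree hp.ne_zero] at hd ⊢
  rw [degree_lt_iff_coeff_zero] at hd ⊢
  intro m hm
  obtain ⟨m, rfl⟩ : ∃ l, m = l + 1 := ⟨m - 1, by omega⟩
  rw [coeff_sub, coeff_X_mul, coeff_C_mul]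
  rcases hm.eq_or_lt with h | h
  · rw [h]
    have : m = p.natDegree - 1 := by omega
    rw [← h, hp.coeff_natDegree, this]; simp
  · rw [coeff_eq_zero_of_natDegree_lt h, hd m (by omega)]; simp

theorem padicDigit_X_mul_zero (hp : p.Monic) (hn : 0 < p.natDegree) (g : K[X]) :
    padicDigit p 0 (X * g) =
      X * padicDigit p 0 g - C ((padicDigit p 0 g).coeff (p.natDegree - 1)) * p := by
  have hg := padicDigit_expansion (p := p) 0 g
  refine padicDigit_eq hp (a := 0)
    (r := C ((padicDigit p 0 g).coeff (p.natDegree - 1)) + X * (g /ₘ p ^ 0 /ₘ p)) ?_ ?_ ?_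
  · have h0 : g %ₘ p ^ 0 = 0 := by simp
    rw [h0] at hg
    linear_combination X * hg
  · simp
  · exact degree_X_mul_sub_lt hp hn (degree_padicDigit_lt hp 0 g)

theorem degree_add_pow_mul_lt (hp : p.Monic) {j : ℕ} {a d : K[X]}
    (ha : a.degree < (p ^ j).degree) (hd : d.degree < p.degree) :
    (a + p ^ j * d).degree < (p ^ (j + 1)).degree := by
  have h1 : (p ^ j * d).degree < (p ^ (j + 1)).degree := by
    rw [pow_succ, degree_mul, degree_mul]
    exact WithBot.add_lt_add_left (degree_ne_bot.2 (hp.pow j).ne_zero) hd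
  have h2 : (p ^ j).degree ≤ (p ^ (j + 1)).degree :=
    degree_le_of_dvd (pow_dvd_pow p (Nat.le_succ j)) (hp.pow _).ne_zero
  exact (degree_add_le _ _).trans_lt (max_lt (ha.trans_le h2) h1)

/-- Multiplying a digit by s may raise its degree to deg p; reducing it subtracts c p, with c its
top coefficient, and c is carried into the constant term of the next digit. This carry is what the
blocks e_n e_1ᵀ of the Jacobson block encode. -/
theorem padicDigit_X_mul_succ (hp : p.Monic) (hn : 0 < p.natDegree) (j : ℕ) (g : K[X]) :
    padicDigit p (j + 1) (X * g) =
      X * padicDigit p (j + 1) g - C ((padicDigit p (j + 1) g).coeff (p.natDegree - 1)) * p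
        + C ((padicDigit p j g).coeff (p.natDegree - 1)) := by
  have hg := padicDigit_expansion (p := p) j g
  have hdd := degree_padicDigit_lt hp j g
  set d := padicDigit p j g with hd
  have haa : (g %ₘ p ^ j).degree < (p ^ j).degree := degree_modByMonic_lt _ (hp.pow j)
  set a := g %ₘ p ^ j
  set q := g /ₘ p ^ j /ₘ p
  have hq := modByMonic_add_div q p
  have hee : (q %ₘ p).degree < p.degree := degree_modByMonic_lt _ hp
  have hd' : padicDigit p (j + 1) g = q %ₘ p := by
    refine padicDigit_eq hp (a := a + p ^ j * d) (r := q /ₘ p) ?_ ?_ hee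
    · rw [hq]
      linear_combination hg
    · exact degree_add_pow_mul_lt hp haa hdd
  rw [hd']
  set e := q %ₘ p
  refine padicDigit_eq hp (a := X * a + p ^ j * (X * d - C (d.coeff (p.natDegree - 1)) * p))
    (r := C (e.coeff (p.natDegree - 1)) + X * (q /ₘ p)) ?_ ?_ ?_
  · rw [pow_succ]
    linear_combination X * hg - X * p ^ j * p * hq
  · have h1 : (X * a).degree < (p ^ (j + 1)).degree := by
      rcases eq_or_ne a 0 with h | h
      · rw [h, mul_zero, degree_zero]
        exact bot_lt_iff_ne_bot.2 (degree_ne_bot.2 (hp.pow _).ne_zero)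
      rw [degree_eq_natDegree h, degree_eq_natDegree (hp.pow j).ne_zero] at haa
      rw [degree_mul, degree_X, degree_eq_natDegree h, degree_eq_natDegree (hp.pow _).ne_zero]
      have haa' : a.natDegree < (p ^ j).natDegree := by exact_mod_cast haa
      have : 1 + a.natDegree < (p ^ (j + 1)).natDegree := by
        rw [hp.natDegree_pow] at haa' ⊢
        rw [add_mul]; omega
      exact_mod_cast this
    have h2 := degree_add_pow_mul_lt hp (j := j) (a := 0) (by
      rw [degree_zero]; exact bot_lt_iff_ne_bot.2 (degree_ne_bot.2 (hp.pow _).ne_zero))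
      (degree_X_mul_sub_lt hp hn hdd)
    rw [zero_add] at h2
    exact (degree_add_le _ _).trans_lt (max_lt h1 h2)
  · refine (degree_add_le _ _).trans_lt (max_lt (degree_X_mul_sub_lt hp hn hee) ?_)
    refine degree_C_le.trans_lt ?_
    rw [degree_eq_natDegree hp.ne_zero]; exact_mod_cast hn

theorem sum_padicDigit_mul_pow (hp : p.Monic) (k : ℕ) (f : K[X]) :
    ∑ j ∈ Finset.range k, padicDigit p j f * p ^ j = f %ₘ p ^ k := by
  induction k with
  | zero => simp
  | succ k ih =>
    rw [Finset.sum_range_succ, ih]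
    have h := padicDigit_expansion (p := p) k f
    have h1 := degree_add_pow_mul_lt hp (degree_modByMonic_lt f (hp.pow k))
      (degree_padicDigit_lt hp k f)
    rw [mul_comm (padicDigit p k f)]
    exact (div_modByMonic_unique (f /ₘ p ^ k /ₘ p) _ (hp.pow (k + 1))
      ⟨by rw [pow_succ]; linear_combination -h, h1⟩).2.symm

end Digits

/-! ### Coefficient vectors of truncated `p`-adic expansions -/

section Vectors

variable (p : K[X]) (k : ℕ)

/-- The coefficients of the first `k` digits of `f`, as a row of the matrix `H` of a block. -/
noncomputable def digitRow (f : K[X]) : Fin k × Fin p.natDegree → K :=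
  fun x => (padicDigit p x.1 f).coeff x.2

/-- The column of the matrix `G` of a block belonging to the polynomial `g`. -/
noncomputable def dualColumn (g : K[X]) : Fin k × Fin p.natDegree → K :=
  fun x => ((fun c => digitRow p k g (x.1.rev, c)) ᵥ* (hankelMatrix p)⁻¹) x.2

variable {p}

theorem digitRow_add (hp : p.Monic) (f g : K[X]) :
    digitRow p k (f + g) = digitRow p k f + digitRow p k g := by
  ext x; simp [digitRow, padicDigit_add hp]

theorem digitRow_C_mul (hp : p.Monic) (c : K) (f : K[X]) :
    digitRow p k (C c * f) = c • digitRow p k f := by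
  ext x; simp [digitRow, padicDigit_C_mul hp]

theorem digitRow_eq_zero_of_dvd (hp : p.Monic) {f : K[X]} (h : p ^ k ∣ f) :
    digitRow p k f = 0 := by
  obtain ⟨g, rfl⟩ := h
  ext x; simp [digitRow, padicDigit_pow_mul_of_lt hp x.1.2]

theorem dualColumn_add (hp : p.Monic) (f g : K[X]) :
    dualColumn p k (f + g) = dualColumn p k f + dualColumn p k g := by
  ext x
  simp only [dualColumn, digitRow_add k hp, Pi.add_apply]
  exact congrFun (Matrix.add_vecMul _ (fun c => digitRow p k f (x.1.rev, c))
    (fun c => digitRow p k g (x.1.rev, c))) x.2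

theorem dualColumn_C_mul (hp : p.Monic) (c : K) (f : K[X]) :
    dualColumn p k (C c * f) = c • dualColumn p k f := by
  ext x
  simp only [dualColumn, digitRow_C_mul k hp, Pi.smul_apply]
  exact congrFun (Matrix.smul_vecMul c (fun c => digitRow p k f (x.1.rev, c)) _) x.2

theorem dualColumn_eq_zero_of_dvd (hp : p.Monic) {f : K[X]} (h : p ^ k ∣ f) :
    dualColumn p k f = 0 := by
  ext x
  simp only [dualColumn, digitRow_eq_zero_of_dvd k hp h, Pi.zero_apply]
  exact congrFun (Matrix.zero_vecMul _) x.2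

/-- Reversing the rows gives a lower triangular matrix whose diagonal entries are the leading
coefficient 1. -/
theorem det_hankelMatrix_isUnit (hp : p.Monic) : IsUnit (hankelMatrix p).det := by
  have h : ((hankelMatrix p).submatrix Fin.revPerm id).det = 1 := by
    rw [det_of_isLowerTriangular]
    · refine Finset.prod_eq_one fun i _ => ?_
      have : (i.rev : ℕ) + i + 1 = p.natDegree := by rw [Fin.val_rev]; omega
      rw [submatrix_apply, Fin.revPerm_apply, id, hankelMatrix, of_apply, this,
        hp.coeff_natDegree]
    · intro i j hij
      have hij' : i < j := hij
      have : p.natDegree < (i.rev : ℕ) + j + 1 := by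
        rw [Fin.val_rev]; have : (i : ℕ) < j := hij'; omega
      rw [submatrix_apply, Fin.revPerm_apply, id, hankelMatrix, of_apply,
        coeff_eq_zero_of_natDegree_lt this]
  rw [det_permute] at h
  exact IsUnit.of_mul_eq_one_right _ h

theorem companion_sum {R : Type*} [CommRing R] (φ : K →+* R) (v : Fin p.natDegree → R)
    (c : Fin p.natDegree) :
    ((companion p).map φ *ᵥ v) c =
      if h : (c : ℕ) + 1 < p.natDegree then v ⟨c + 1, h⟩
      else - ∑ j : Fin p.natDegree, φ (p.coeff j) * v j := by
  by_cases h : (c : ℕ) + 1 < p.natDegree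
  · have hc : (c : ℕ) + 1 ≠ p.natDegree := by omega
    simp only [mulVec, dotProduct, companion, Matrix.map_apply, of_apply, h, hc, if_false,
      dite_true]
    rw [Finset.sum_eq_single ⟨c + 1, h⟩]
    · simp
    · intro b _ hb
      rw [if_neg (fun hcb => hb (Fin.ext hcb.symm))]; simp
    · simp
  · have hc : (c : ℕ) + 1 = p.natDegree := by omega
    simp [mulVec, dotProduct, companion, hc]

theorem hankelMatrix_transpose : (hankelMatrix p)ᵀ = hankelMatrix p := by
  ext i j; simp [hankelMatrix, add_comm]

/-- The entries of M C(p), computed in `key`, are symmetric in i and j, and M itself is symmetric.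
Hence C(p)ᵀ M = (M C(p))ᵀ = M C(p). -/
theorem companion_transpose_mul_hankelMatrix (hp : p.Monic) :
    (companion p)ᵀ * hankelMatrix p = hankelMatrix p * companion p := by
  have key : ∀ i j, (hankelMatrix p * companion p) i j =
      if (i : ℕ) = 0 then (if (j : ℕ) = 0 then - p.coeff 0 else 0)
      else if (j : ℕ) = 0 then 0 else p.coeff (i + j) := by
    intro i j
    have hn : 0 < p.natDegree := i.pos
    have hs : ∀ c : Fin p.natDegree, companion p c j =
        (if c = ⟨p.natDegree - 1, by omega⟩ then - p.coeff j else 0) +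
        (if (c : ℕ) + 1 = j then 1 else 0) := by
      intro c
      simp only [companion, of_apply, Fin.ext_iff]
      split_ifs <;> first | omega | simp
    simp only [mul_apply, hs, mul_add, Finset.sum_add_distrib, mul_ite, mul_zero, mul_one,
      Finset.sum_ite_eq', Finset.mem_univ, if_true]
    have h1 : hankelMatrix p i ⟨p.natDegree - 1, by omega⟩ = if (i : ℕ) = 0 then 1 else 0 := by
      simp only [hankelMatrix, of_apply]
      split_ifs with hi
      · have : (i : ℕ) + (p.natDegree - 1) + 1 = p.natDegree := by omega
        rw [this, hp.coeff_natDegree]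
      · exact coeff_eq_zero_of_natDegree_lt (by omega)
    have h2 : (∑ c : Fin p.natDegree, if (c : ℕ) + 1 = j then hankelMatrix p i c else 0) =
        if (j : ℕ) = 0 then 0 else p.coeff (i + j) := by
      split_ifs with hj
      · exact Finset.sum_eq_zero fun c _ => if_neg (by omega)
      · rw [Finset.sum_eq_single ⟨j - 1, by omega⟩]
        · have : (j : ℕ) - 1 + 1 = j := by omega
          simp only [this, if_true, hankelMatrix, of_apply]
          congr 1; omega
        · intro b _ hb
          refine if_neg fun h => hb (Fin.ext ?_)
          simp only; omega
        · simp
    rw [h1, h2]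
    by_cases hi : (i : ℕ) = 0 <;> by_cases hj : (j : ℕ) = 0 <;> simp [hi, hj]
  rw [← hankelMatrix_transpose, ← transpose_mul, hankelMatrix_transpose]
  ext i j
  rw [transpose_apply, key, key]
  by_cases hi : (i : ℕ) = 0 <;> by_cases hj : (j : ℕ) = 0 <;> simp [hi, hj, add_comm]

theorem companion_mul_hankelMatrix_inv (hp : p.Monic) :
    companion p * (hankelMatrix p)⁻¹ = (hankelMatrix p)⁻¹ * (companion p)ᵀ := by
  have hu := det_hankelMatrix_isUnit hp
  have h := companion_transpose_mul_hankelMatrix hp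
  calc companion p * (hankelMatrix p)⁻¹
      = (hankelMatrix p)⁻¹ * (hankelMatrix p * companion p) * (hankelMatrix p)⁻¹ := by
        rw [← Matrix.mul_assoc, nonsing_inv_mul _ hu, Matrix.one_mul]
    _ = (hankelMatrix p)⁻¹ * (companion p)ᵀ := by
        rw [← h, ← Matrix.mul_assoc, Matrix.mul_assoc _ (hankelMatrix p), mul_nonsing_inv _ hu,
          Matrix.mul_one]

theorem hankelMatrix_last (hp : p.Monic) (hn : 0 < p.natDegree) :
    (Pi.single ⟨p.natDegree - 1, by omega⟩ 1 : Fin p.natDegree → K) ᵥ* hankelMatrix p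
      = Pi.single ⟨0, hn⟩ 1 := by
  ext c
  rw [single_one_vecMul]
  by_cases hc : (c : ℕ) = 0
  · have : c = ⟨0, hn⟩ := Fin.ext hc
    subst this
    have : p.natDegree - 1 + 0 + 1 = p.natDegree := by omega
    simp [hankelMatrix, this, hp.coeff_natDegree]
  · have : c ≠ ⟨0, hn⟩ := fun h => hc (by rw [h])
    rw [Pi.single_eq_of_ne this]
    exact coeff_eq_zero_of_natDegree_lt (by simp only; omega)

/-- A carry enters a digit in coordinate 0; in the dual coordinates it appears in the last
coordinate, which is the row where the corner matrix acts. -/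
theorem single_vecMul_hankelMatrix_inv (hp : p.Monic) (hn : 0 < p.natDegree) :
    (Pi.single ⟨0, hn⟩ 1 : Fin p.natDegree → K) ᵥ* (hankelMatrix p)⁻¹
      = Pi.single ⟨p.natDegree - 1, by omega⟩ 1 := by
  rw [← hankelMatrix_last hp hn, vecMul_vecMul, mul_nonsing_inv _ (det_hankelMatrix_isUnit hp),
    vecMul_one]

end Vectors

/-! ### Multiplication by s and the action of a Jacobson block -/

section Block

variable {p : K[X]} {k : ℕ}

theorem jacobsonBlock_mulVec {R : Type*} [CommRing R] (φ : K →+* R)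
    (v : Fin k × Fin p.natDegree → R) (i : Fin k) (c : Fin p.natDegree) :
    ((jacobsonBlock p k).map φ *ᵥ v) (i, c) =
      ((companion p).map φ *ᵥ fun c' => v (i, c')) c +
      if h : (i : ℕ) + 1 < k ∧ (c : ℕ) + 1 = p.natDegree then
        v (⟨i + 1, h.1⟩, ⟨0, c.pos⟩) else 0 := by
  simp only [jacobsonBlock, mulVec, dotProduct, Fintype.sum_prod_type, Matrix.map_apply,
    Matrix.add_apply, kroneckerMap_apply, map_add, add_mul, Finset.sum_add_distrib, map_mul]
  congr 1
  · rw [Finset.sum_eq_single i]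
    · simp
    · intro b _ hb; simp [hb.symm]
    · simp
  · split_ifs with h
    · rw [Finset.sum_eq_single ⟨i + 1, h.1⟩, Finset.sum_eq_single ⟨0, c.pos⟩]
      · simp [shiftMatrix, cornerMatrix, h.2]
      · intro b _ hb
        have : (b : ℕ) ≠ 0 := fun h => hb (Fin.ext h)
        simp [cornerMatrix, this]
      · simp
      · intro b _ hb
        have : (i : ℕ) + 1 ≠ b := fun h => hb (Fin.ext h.symm)
        simp [shiftMatrix, this]
      · simp
    · refine Finset.sum_eq_zero fun x _ => Finset.sum_eq_zero fun y _ => ?_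
      simp only [shiftMatrix, cornerMatrix, of_apply]
      by_cases h1 : (i : ℕ) + 1 = x
      · have h2 : ¬ ((c : ℕ) + 1 = p.natDegree) := fun h2 => h ⟨by omega, h2⟩
        simp [h2]
      · simp [h1]

variable (p k) in
/-- The last unit vector, a cyclic vector of the Jacobson block. -/
def lastVector : Fin k × Fin p.natDegree → K :=
  fun x => if (x.1 : ℕ) + 1 = k ∧ (x.2 : ℕ) + 1 = p.natDegree then 1 else 0

variable (p k) in
/-- The vector with entries `pⁱ s^c`. -/
noncomputable def powerVector : Fin k × Fin p.natDegree → K[X] :=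
  fun x => p ^ (x.1 : ℕ) * X ^ (x.2 : ℕ)

theorem dualColumn_one (hp : p.Monic) (hn : 0 < p.natDegree) :
    dualColumn p k 1 = lastVector p k := by
  ext ⟨i, c⟩
  have hrow : (fun c => digitRow p k 1 (i.rev, c)) =
      (if (i : ℕ) + 1 = k then 1 else 0 : K) • (Pi.single ⟨0, hn⟩ 1 : Fin p.natDegree → K) := by
    ext c
    have hi : ((i.rev : ℕ) = 0) ↔ (i : ℕ) + 1 = k := by rw [Fin.val_rev]; omega
    simp only [digitRow, padicDigit_one hp hn, hi]
    split_ifs with h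
    · by_cases hc : (c : ℕ) = 0
      · have : c = ⟨0, hn⟩ := Fin.ext hc
        subst this; simp
      · have : c ≠ ⟨0, hn⟩ := fun h => hc (by rw [h])
        simp [this, coeff_one, hc]
    · simp
  simp only [dualColumn, hrow, smul_vecMul, single_vecMul_hankelMatrix_inv hp hn, lastVector,
    Pi.smul_apply, Pi.single_apply, Fin.ext_iff, smul_eq_mul]
  have : (c : ℕ) = p.natDegree - 1 ↔ (c : ℕ) + 1 = p.natDegree := by omega
  simp only [this]
  by_cases h1 : (i : ℕ) + 1 = k <;> by_cases h2 : (c : ℕ) + 1 = p.natDegree <;> simp [h1, h2]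

theorem coeff_X_mul_sub (hn : 0 < p.natDegree) (d : K[X]) :
    (fun c : Fin p.natDegree => (X * d - C (d.coeff (p.natDegree - 1)) * p).coeff c) =
      (fun c : Fin p.natDegree => d.coeff c) ᵥ* companion p := by
  ext c
  have hs : ∀ i : Fin p.natDegree, companion p i c =
      (if i = ⟨p.natDegree - 1, by omega⟩ then - p.coeff c else 0) +
      (if (i : ℕ) + 1 = c then 1 else 0) := by
    intro i
    simp only [companion, of_apply, Fin.ext_iff]
    split_ifs <;> first | omega | simp
  simp only [vecMul, dotProduct, hs, mul_add, Finset.sum_add_distrib, mul_ite, mul_zero, mul_one,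
    Finset.sum_ite_eq', Finset.mem_univ, if_true, coeff_sub, coeff_C_mul]
  have h2 : (∑ i : Fin p.natDegree, if (i : ℕ) + 1 = c then d.coeff i else 0) =
      (X * d).coeff c := by
    rcases Nat.eq_zero_or_pos (c : ℕ) with hc | hc
    · rw [hc, coeff_X_mul_zero]
      exact Finset.sum_eq_zero fun c _ => if_neg (by omega)
    · have hc' : (c : ℕ) = (c - 1 : ℕ) + 1 := by omega
      rw [Finset.sum_eq_single ⟨c - 1, by omega⟩]
      · have := coeff_X_mul d (c - 1 : ℕ)
        rw [← hc'] at this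
        rw [if_pos hc'.symm, this]
      · intro b _ hb
        refine if_neg fun h => hb (Fin.ext ?_)
        simp only; omega
      · simp
  rw [h2]; ring

/-- Multiplication by `s` corresponds to multiplication by the Jacobson block. -/
theorem dualColumn_X_mul (hp : p.Monic) (hn : 0 < p.natDegree) (g : K[X]) :
    dualColumn p k (X * g) = jacobsonBlock p k *ᵥ dualColumn p k g := by
  ext ⟨i, c⟩
  have hJ := jacobsonBlock_mulVec (RingHom.id K) (dualColumn p k g) i c
  simp only [RingHom.coe_id, Matrix.map_id] at hJ
  rw [hJ]
  -- Block i holds digit k - 1 - i, so the next lower digit, the source of the carry, sits in block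
  -- i + 1. The last block holds digit 0 and receives no carry.
  have hrow : (fun c => digitRow p k (X * g) (i.rev, c)) =
      (fun c => digitRow p k g (i.rev, c)) ᵥ* companion p +
      (if h : (i : ℕ) + 1 < k then
        (padicDigit p ((⟨i + 1, h⟩ : Fin k).rev : ℕ) g).coeff (p.natDegree - 1) else 0) •
        (Pi.single ⟨0, hn⟩ 1 : Fin p.natDegree → K) := by
    unfold digitRow
    simp only
    rw [← coeff_X_mul_sub hn]
    by_cases h : (i : ℕ) + 1 < k
    · have h1 : (i.rev : ℕ) = ((⟨i + 1, h⟩ : Fin k).rev : ℕ) + 1 := by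
        simp only [Fin.val_rev]; omega
      rw [dif_pos h, h1]
      ext c
      rw [padicDigit_X_mul_succ hp hn]
      simp only [coeff_add, Pi.add_apply, Pi.smul_apply, coeff_C, Pi.single_apply, Fin.ext_iff,
        smul_eq_mul, mul_ite, mul_one, mul_zero]
    · have h1 : (i.rev : ℕ) = 0 := by simp only [Fin.val_rev]; omega
      rw [dif_neg h, h1]
      ext c
      rw [padicDigit_X_mul_zero hp hn]
      simp
  -- The last column of M is e_1, so the first dual coordinate of a block is the top coefficient of
  -- its digit: the corner matrix reads off the carry.
  have h0 : ∀ i : Fin k, dualColumn p k g (i, ⟨0, hn⟩) =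
      (padicDigit p (i.rev : ℕ) g).coeff (p.natDegree - 1) := by
    intro i
    have : (fun c => dualColumn p k g (i, c)) ᵥ* hankelMatrix p =
        fun c => digitRow p k g (i.rev, c) := by
      unfold dualColumn
      simp only
      rw [vecMul_vecMul, nonsing_inv_mul _ (det_hankelMatrix_isUnit hp), vecMul_one]
    have h := congrFun this ⟨p.natDegree - 1, by omega⟩
    have h' := hankelMatrix_last hp hn
    rw [single_one_vecMul] at h'
    have h'' : ∀ c, hankelMatrix p c ⟨p.natDegree - 1, by omega⟩ =
        (Pi.single ⟨0, hn⟩ 1 : Fin p.natDegree → K) c := by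
      intro c
      rw [← h', row_apply, ← hankelMatrix_transpose, transpose_apply, hankelMatrix_transpose]
    simp only [vecMul, dotProduct, h'', digitRow] at h
    rw [← h]
    simp [Pi.single_apply]
  have hcol : dualColumn p k (X * g) (i, c) = ((fun c => digitRow p k (X * g) (i.rev, c)) ᵥ*
    (hankelMatrix p)⁻¹) c := rfl
  rw [hcol, hrow, add_vecMul, vecMul_vecMul, companion_mul_hankelMatrix_inv hp,
    ← vecMul_vecMul, vecMul_transpose, smul_vecMul, single_vecMul_hankelMatrix_inv hp hn]
  rw [Pi.add_apply]
  refine congrArg₂ (· + ·) rfl ?_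
  simp only [Pi.smul_apply, Pi.single_apply, Fin.ext_iff, smul_eq_mul]
  have : (c : ℕ) = p.natDegree - 1 ↔ (c : ℕ) + 1 = p.natDegree := by omega
  simp only [this]
  by_cases h1 : (i : ℕ) + 1 < k <;> by_cases h2 : (c : ℕ) + 1 = p.natDegree <;>
    simp [h1, h2, h0]

theorem sum_coeff_mul_X_pow (hp : p.Monic) :
    (∑ j : Fin p.natDegree, C (p.coeff j) * X ^ (j : ℕ)) + X ^ p.natDegree = p := by
  conv_rhs => rw [hp.as_sum]
  rw [add_comm, Finset.sum_range (fun i => C (p.coeff i) * X ^ i)]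

/-- Within a block the entries pⁱ sᶜ cancel by the shift. In the last row of block i the companion
matrix produces pⁱ p, which the corner block cancels with pⁱ⁺¹, except in the last block, where pᵏ
remains. -/
theorem charmatrix_jacobsonBlock_mulVec_powerVector (hp : p.Monic) :
    (jacobsonBlock p k).charmatrix *ᵥ powerVector p k =
      fun x => p ^ k * C (lastVector p k x) := by
  ext1 ⟨i, c⟩
  rw [charmatrix, sub_mulVec, Pi.sub_apply, RingHom.mapMatrix_apply, jacobsonBlock_mulVec,
    companion_sum]
  have h0 : (scalar (Fin k × Fin p.natDegree) (X : K[X]) *ᵥ powerVector p k) (i, c) =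
      X * (p ^ (i : ℕ) * X ^ (c : ℕ)) := by
    rw [scalar_apply, mulVec_diagonal]; rfl
  rw [h0]
  have hsum := sum_coeff_mul_X_pow hp
  simp only [powerVector, lastVector]
  by_cases h2 : (c : ℕ) + 1 < p.natDegree
  · have h3 : ¬ ((c : ℕ) + 1 = p.natDegree) := by omega
    simp only [h2, h3, and_false, dite_true, dite_false, if_false]
    simp; ring
  · have h3 : (c : ℕ) + 1 = p.natDegree := by omega
    have h4 : ∑ j : Fin p.natDegree, C (p.coeff j) * (p ^ (i : ℕ) * X ^ (j : ℕ)) =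
        p ^ (i : ℕ) * (p - X ^ ((c : ℕ) + 1)) := by
      rw [h3]
      rw [← eq_sub_iff_add_eq.2 hsum, Finset.mul_sum]
      exact Finset.sum_congr rfl fun j _ => by ring
    simp only [h3, and_true, h4]
    by_cases h1 : (i : ℕ) + 1 < k
    · have h5 : ¬ ((i : ℕ) + 1 = k) := by omega
      simp only [h1, h5, dite_true, if_false]
      simp [← h3]; ring
    · have h5 : (i : ℕ) + 1 = k := by omega
      simp only [h5, if_true]
      have : p ^ k = p ^ (i : ℕ) * p := by rw [← pow_succ, h5]
      rw [this]
      simp [← h3]; ring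

end Block

/-! ### Realization by a single Jacobson block -/

section Pairing

variable {p : K[X]} {k : ℕ}

theorem matResolvent_mulVec_lastVector (hp : p.Monic) :
    matResolvent (jacobsonBlock p k) *ᵥ (fun x => RatFunc.C (lastVector p k x)) =
      fun x => toRat (powerVector p k x) / toRat (p ^ k) := by
  have hpk := toRat_ne_zero (hp.pow k).ne_zero
  have h := charmatrix_jacobsonBlock_mulVec_powerVector (k := k) hp
  have h1 : (jacobsonBlock p k).charmatrix.map toRat *ᵥ (fun x => toRat (powerVector p k x)) =
      toRat (p ^ k) • fun x => RatFunc.C (lastVector p k x) := by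
    ext x
    have := congrArg toRat (congrFun h x)
    rw [toRat_mul, toRat_C] at this
    rw [Pi.smul_apply, smul_eq_mul, ← this, toRat, RingHom.map_mulVec]
    rfl
  have h2 : (fun x => RatFunc.C (lastVector p k x)) =
      (toRat (p ^ k))⁻¹ • ((jacobsonBlock p k).charmatrix.map toRat *ᵥ
        fun x => toRat (powerVector p k x)) := by
    rw [h1, smul_smul, inv_mul_cancel₀ hpk, one_smul]
  rw [h2, mulVec_smul, mulVec_mulVec, matResolvent_mul_charmatrix, one_mulVec]
  ext x
  simp [div_eq_inv_mul]

/-- Constants reduce to the last unit vector. Passing from g to s g inserts J after the resolvent,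
and (sI - J)⁻¹ J = s (sI - J)⁻¹ - I only adds polynomial terms. -/
theorem matResolvent_mulVec_dualColumn (hp : p.Monic) (hn : 0 < p.natDegree) (g : K[X]) :
    ∃ y : Fin k × Fin p.natDegree → K[X],
      matResolvent (jacobsonBlock p k) *ᵥ (fun x => RatFunc.C (dualColumn p k g x)) =
      fun x => toRat (g * powerVector p k x) / toRat (p ^ k) + toRat (y x) := by
  induction g using Polynomial.induction_on with
  | C a =>
    refine ⟨0, ?_⟩
    have h : (fun x => RatFunc.C (dualColumn p k (C a) x)) =
        RatFunc.C a • fun x => RatFunc.C (lastVector p k x) := by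
      ext x
      rw [← mul_one (C a), dualColumn_C_mul k hp, dualColumn_one hp hn]
      simp
    rw [h, mulVec_smul, matResolvent_mulVec_lastVector hp]
    ext x
    simp [toRat, mul_div_assoc]
  | add f g hf hg =>
    obtain ⟨y, hy⟩ := hf
    obtain ⟨z, hz⟩ := hg
    refine ⟨y + z, ?_⟩
    have h : (fun x => RatFunc.C (dualColumn p k (f + g) x)) =
        (fun x => RatFunc.C (dualColumn p k f x)) + fun x => RatFunc.C (dualColumn p k g x) := by
      ext x
      simp [dualColumn_add k hp]
    rw [h, mulVec_add, hy, hz]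
    ext x
    simp only [Pi.add_apply, add_mul, toRat_add, add_div]
    ring
  | monomial n a ih =>
    obtain ⟨y, hy⟩ := ih
    have h0 : (C a * X ^ (n + 1) : K[X]) = X * (C a * X ^ n) := by ring
    refine ⟨fun x => X * y x - C (dualColumn p k (C a * X ^ n) x), ?_⟩
    have h : (fun x => RatFunc.C (dualColumn p k (X * (C a * X ^ n)) x)) =
        (jacobsonBlock p k).map RatFunc.C *ᵥ
          fun x => RatFunc.C (dualColumn p k (C a * X ^ n) x) := by
      ext x
      rw [dualColumn_X_mul hp hn, RingHom.map_mulVec]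
      rfl
    rw [h0, h, mulVec_mulVec, matResolvent_mul_const, sub_mulVec, smul_mulVec, hy, one_mulVec]
    ext x
    simp only [Pi.sub_apply, Pi.smul_apply, smul_eq_mul, toRat_sub, toRat_mul, toRat_C, toRat_X]
    ring

theorem sum_digitRow_mul_powerVector (hp : p.Monic) (hn : 0 < p.natDegree) (f : K[X]) :
    ∑ x, C (digitRow p k f x) * powerVector p k x = f %ₘ p ^ k := by
  rw [← sum_padicDigit_mul_pow hp, Finset.sum_range, Fintype.sum_prod_type]
  refine Finset.sum_congr rfl fun j _ => ?_
  have h : padicDigit p j f =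
      ∑ c : Fin p.natDegree, C ((padicDigit p j f).coeff c) * X ^ (c : ℕ) := by
    have h1 : p ≠ 1 := by rintro rfl; simp at hn
    conv_lhs => rw [as_sum_range' (padicDigit p j f) p.natDegree (natDegree_modByMonic_lt _ hp h1)]
    rw [Finset.sum_range]
    simp only [C_mul_X_pow_eq_monomial]
  conv_rhs => rw [h]
  rw [Finset.sum_mul]
  refine Finset.sum_congr rfl fun c _ => ?_
  simp only [digitRow, powerVector]
  ring

/-- Realization of `f p⁻ᵏ g` by a Jacobson block, up to a polynomial. -/
theorem digitRow_dotProduct_matResolvent (hp : p.Monic) (hn : 0 < p.natDegree) (f g : K[X]) :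
    ∃ y : K[X], (fun x => RatFunc.C (digitRow p k f x)) ⬝ᵥ
      (matResolvent (jacobsonBlock p k) *ᵥ fun x => RatFunc.C (dualColumn p k g x)) =
      toRat (f * g) / toRat (p ^ k) + toRat y := by
  obtain ⟨y, hy⟩ := matResolvent_mulVec_dualColumn (k := k) hp hn g
  -- The digit row sees f only modulo pᵏ; the discarded quotient contributes the polynomial g (f /
  -- pᵏ).
  refine ⟨∑ x, C (digitRow p k f x) * y x - g * (f /ₘ p ^ k), ?_⟩
  have hpk := toRat_ne_zero (hp.pow k).ne_zero
  have h1 : (fun x => RatFunc.C (digitRow p k f x)) ⬝ᵥ (fun x =>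
      toRat (g * powerVector p k x) / toRat (p ^ k) + toRat (y x)) =
      toRat g * toRat (f %ₘ p ^ k) / toRat (p ^ k) + toRat (∑ x, C (digitRow p k f x) * y x) := by
    rw [← sum_digitRow_mul_powerVector hp hn, toRat_sum, toRat_sum, Finset.mul_sum, Finset.sum_div,
      ← Finset.sum_add_distrib]
    refine Finset.sum_congr rfl fun x _ => ?_
    simp only [toRat_mul, toRat_C]
    ring
  have h2 : toRat f = toRat (f %ₘ p ^ k) + toRat (p ^ k) * toRat (f /ₘ p ^ k) := by
    rw [← toRat_mul, ← toRat_add, modByMonic_add_div]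
  rw [hy, h1, toRat_sub, toRat_mul, toRat_mul, h2]
  field_simp
  ring

/-- The polynomials pʲ sᶜ have the unit vectors as digit rows, so arbitrary state vectors can be
replaced by polynomials in the minimality arguments. -/
theorem exists_digitRow_eq (hp : p.Monic) (v : Fin k × Fin p.natDegree → K) :
    ∃ f, digitRow p k f = v := by
  have hb : ∀ x, digitRow p k (powerVector p k x) = Pi.single x 1 := by
    rintro ⟨j, c⟩
    have hc : (X ^ (c : ℕ) : K[X]).degree < p.degree := by
      rw [degree_X_pow, degree_eq_natDegree hp.ne_zero]; exact_mod_cast c.2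
    have hbot : ∀ q : K[X], q.Monic → (0 : K[X]).degree < q.degree := fun q hq => by
      rw [degree_zero]; exact bot_lt_iff_ne_bot.2 (degree_ne_bot.2 hq.ne_zero)
    ext ⟨i, d⟩
    simp only [digitRow, powerVector]
    rcases lt_trichotomy i j with h | h | h
    · have hne : ((i, d) : Fin k × Fin p.natDegree) ≠ (j, c) := fun e => h.ne (Prod.ext_iff.1 e).1
      rw [padicDigit_pow_mul_of_lt hp h, Pi.single_eq_of_ne hne, coeff_zero]
    · subst h
      rw [padicDigit_eq hp (a := 0) (r := 0) (d := X ^ (c : ℕ)) (by ring) (hbot _ (hp.pow _)) hc,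
        coeff_X_pow]
      simp [Pi.single_apply, Fin.ext_iff]
    · have hne : ((i, d) : Fin k × Fin p.natDegree) ≠ (j, c) := fun e => h.ne' (Prod.ext_iff.1 e).1
      rw [padicDigit_eq hp (a := p ^ (j : ℕ) * X ^ (c : ℕ)) (r := 0) (d := 0) (by ring) ?_
        (hbot p hp), Pi.single_eq_of_ne hne, coeff_zero]
      have h1 := degree_add_pow_mul_lt hp (j := j) (hbot _ (hp.pow _)) hc
      rw [zero_add] at h1
      exact h1.trans_le (degree_le_of_dvd (pow_dvd_pow p h) (hp.pow _).ne_zero)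
  refine ⟨∑ x, C (v x) * powerVector p k x, ?_⟩
  have hs : digitRow p k (∑ x, C (v x) * powerVector p k x) =
      ∑ x, digitRow p k (C (v x) * powerVector p k x) :=
    map_sum (AddMonoidHom.mk' (digitRow p k) (digitRow_add k hp)) _ _
  rw [hs]
  simp only [digitRow_C_mul k hp, hb]
  ext x
  simp [Finset.sum_apply, Pi.single_apply]

theorem exists_dualColumn_eq (hp : p.Monic) (v : Fin k × Fin p.natDegree → K) :
    ∃ f, dualColumn p k f = v := by
  obtain ⟨f, hf⟩ := exists_digitRow_eq hp fun x : Fin k × Fin p.natDegree =>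
    ((fun c => v (x.1.rev, c)) ᵥ* hankelMatrix p) x.2
  refine ⟨f, ?_⟩
  ext ⟨i, c⟩
  simp only [dualColumn, hf, Fin.rev_rev]
  exact (congrFun (vecMul_vecMul _ _ _) c).trans (by
    rw [mul_nonsing_inv _ (det_hankelMatrix_isUnit hp), vecMul_one])

end Pairing

/-! ### Direct sums of Jacobson blocks -/

section Diagonal

theorem charmatrix_blockDiagonal' {ι : Type*} [Fintype ι] [DecidableEq ι] {n : ι → Type*}
    [∀ i, Fintype (n i)] [∀ i, DecidableEq (n i)] (M : ∀ i, Matrix (n i) (n i) K) :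
    (blockDiagonal' M).charmatrix = blockDiagonal' fun i => (M i).charmatrix := by
  refine Matrix.ext fun x y => ?_
  obtain ⟨i, a⟩ := x
  obtain ⟨j, b⟩ := y
  by_cases h : i = j
  · subst h
    rw [blockDiagonal'_apply_eq]
    by_cases hab : a = b
    · subst hab; simp
    · rw [charmatrix_apply_ne _ _ _ hab, charmatrix_apply_ne _ _ _ (by simpa using hab),
        blockDiagonal'_apply_eq]
  · rw [blockDiagonal'_apply_ne _ _ _ h, charmatrix_apply_ne _ _ _ (by simp [h]),
      blockDiagonal'_apply_ne _ _ _ h]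
    simp

theorem matResolvent_blockDiagonal' {ι : Type*} [Fintype ι] [DecidableEq ι] {n : ι → Type*}
    [∀ i, Fintype (n i)] [∀ i, DecidableEq (n i)] (M : ∀ i, Matrix (n i) (n i) K) :
    matResolvent (blockDiagonal' M) = blockDiagonal' fun i => matResolvent (M i) := by
  rw [matResolvent_eq]
  refine inv_eq_right_inv ?_
  rw [charmatrix_blockDiagonal', blockDiagonal'_map _ _ (map_zero _), ← blockDiagonal'_mul]
  simp only [charmatrix_mul_matResolvent]
  exact blockDiagonal'_one

variable {ι : Type*} [Fintype ι] [DecidableEq ι] (p : ι → K[X]) (k : ι → ℕ)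

/-- Since f and g are arbitrary, this formula computes the entries of H(sI - F)⁻¹G and also serves
for observability and controllability, where one side is an arbitrary state vector. -/
theorem jacobsonDiag_pairing (hp : ∀ x, (p x).Monic) (hn : ∀ x, 0 < (p x).natDegree)
    (f g : ι → K[X]) :
    ∃ y : K[X], (fun z : Σ i, Fin (k i) × Fin (p i).natDegree =>
        RatFunc.C (digitRow (p z.1) (k z.1) (f z.1) z.2)) ⬝ᵥ
      (matResolvent (jacobsonDiag p k) *ᵥ
        fun z => RatFunc.C (dualColumn (p z.1) (k z.1) (g z.1) z.2)) =
      ∑ x, toRat (f x * g x) / toRat (p x ^ k x) + toRat y := by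
  choose y hy using fun x => digitRow_dotProduct_matResolvent (k := k x) (hp x) (hn x) (f x) (g x)
  refine ⟨∑ x, y x, ?_⟩
  rw [toRat_sum, ← Finset.sum_add_distrib]
  simp only [← hy]
  rw [jacobsonDiag, matResolvent_blockDiagonal', dotProduct, Fintype.sum_sigma]
  refine Finset.sum_congr rfl fun x _ => Finset.sum_congr rfl fun z _ => ?_
  congr 1
  simp only [mulVec, dotProduct]
  rw [Fintype.sum_sigma, Finset.sum_eq_single x]
  · simp only [blockDiagonal'_apply_eq]
  · intro x' _ hx
    exact Finset.sum_eq_zero fun z' _ => by rw [blockDiagonal'_apply_ne _ _ _ hx.symm, zero_mul]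
  · simp

end Diagonal

/-! ### Partial fractions -/

/-- After clearing denominators, every term except the one of index μ is divisible by the μ-th
denominator, whose cofactor is coprime to it. -/
theorem pow_dvd_of_sum_div_eq_toRat {ι : Type*} [Fintype ι] {p : ι → K[X]}
    (hp : ∀ μ, p μ ≠ 0) (hcop : Pairwise fun μ ν => IsCoprime (p μ) (p ν)) (N : ι → ℕ)
    {b : ι → K[X]} {y : K[X]}
    (h : ∑ μ, toRat (b μ) / toRat (p μ ^ N μ) = toRat y) (μ : ι) : p μ ^ N μ ∣ b μ := by
  classical
  have h1 : ∑ ν, b ν * ∏ κ ∈ Finset.univ.erase ν, p κ ^ N κ = y * ∏ κ, p κ ^ N κ := by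
    apply toRat_injective
    rw [toRat_mul, ← h, toRat_sum, Finset.sum_mul]
    refine Finset.sum_congr rfl fun ν _ => ?_
    have hne := toRat_ne_zero (pow_ne_zero (N ν) (hp ν))
    rw [← Finset.mul_prod_erase _ (fun κ => p κ ^ N κ) (Finset.mem_univ ν), toRat_mul, toRat_mul,
      ← mul_assoc, div_mul_cancel₀ _ hne]
  have h2 : p μ ^ N μ ∣ b μ * ∏ κ ∈ Finset.univ.erase μ, p κ ^ N κ := by
    rw [← Finset.add_sum_erase _ _ (Finset.mem_univ μ)] at h1
    rw [eq_sub_of_add_eq h1]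
    refine dvd_sub ((Finset.dvd_prod_of_mem (fun κ => p κ ^ N κ) (Finset.mem_univ μ)).mul_left _)
      (Finset.dvd_sum fun ν hν => ?_)
    exact (Finset.dvd_prod_of_mem (fun κ => p κ ^ N κ)
      (Finset.mem_erase.2 ⟨(Finset.ne_of_mem_erase hν).symm, Finset.mem_univ μ⟩)).mul_left _
  refine IsCoprime.dvd_of_dvd_mul_right ?_ h2
  exact IsCoprime.prod_right fun κ hκ => (hcop (Finset.ne_of_mem_erase hκ).symm).pow

/-- For each prime the terms combine into W e over one power of p. Partial fractions make that power
divide W e, and inverting W makes it divide e, whose entries are the c's up to powers of p. -/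
theorem pow_dvd_of_unimodular_combination {m n : ℕ} {p : Fin m → K[X]}
    (hp : ∀ μ, p μ ≠ 0) (hcop : Pairwise fun μ ν => IsCoprime (p μ) (p ν))
    {W : Fin m → Matrix (Fin n) (Fin n) K[X]} (hW : ∀ μ, IsUnit (W μ).det) {r : Fin m → ℕ}
    {col : ∀ μ, Fin (r μ) → Fin n} (hcol : ∀ μ, Function.Injective (col μ))
    (k : (Σ μ, Fin (r μ)) → ℕ) (c : (Σ μ, Fin (r μ)) → K[X])
    (h : ∀ i, ∃ y, ∑ x : Σ μ, Fin (r μ),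
      toRat (W x.1 i (col x.1 x.2) * c x) / toRat (p x.1 ^ k x) = toRat y)
    (x : Σ μ, Fin (r μ)) : p x.1 ^ k x ∣ c x := by
  classical
  obtain ⟨μ, l⟩ := x
  -- Any common upper bound of the exponents for the prime would do; the sum is a convenient one.
  set N : Fin m → ℕ := fun μ => ∑ l, k ⟨μ, l⟩ with hN
  have hk : ∀ μ l, k ⟨μ, l⟩ ≤ N μ := fun μ l =>
    Finset.single_le_sum (f := fun l => k ⟨μ, l⟩) (fun _ _ => Nat.zero_le _) (Finset.mem_univ l)
  let e : ∀ μ, Fin n → K[X] := fun μ y =>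
    ∑ l, if y = col μ l then c ⟨μ, l⟩ * p μ ^ (N μ - k ⟨μ, l⟩) else 0
  have he : ∀ μ i, (W μ *ᵥ e μ) i =
      ∑ l, W μ i (col μ l) * (c ⟨μ, l⟩ * p μ ^ (N μ - k ⟨μ, l⟩)) := by
    intro μ i
    simp only [mulVec, dotProduct, e, Finset.mul_sum]
    rw [Finset.sum_comm]
    simp
  have hdvd : ∀ i, p μ ^ N μ ∣ (W μ *ᵥ e μ) i := by
    intro i
    obtain ⟨y, hy⟩ := h i
    refine pow_dvd_of_sum_div_eq_toRat hp hcop N (b := fun μ => (W μ *ᵥ e μ) i) (y := y) ?_ μ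
    rw [← hy, Fintype.sum_sigma]
    refine Finset.sum_congr rfl fun ν _ => ?_
    rw [he, toRat_sum, Finset.sum_div]
    refine Finset.sum_congr rfl fun l _ => ?_
    have h1 := toRat_ne_zero (pow_ne_zero (N ν) (hp ν))
    have h2 := toRat_ne_zero (pow_ne_zero (k ⟨ν, l⟩) (hp ν))
    have h3 : p ν ^ N ν = p ν ^ (N ν - k ⟨ν, l⟩) * p ν ^ k ⟨ν, l⟩ := by
      rw [← pow_add, Nat.sub_add_cancel (hk ν l)]
    rw [div_eq_div_iff h1 h2, ← toRat_mul, ← toRat_mul, h3]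
    congr 1
    ring
  have hdvd' : p μ ^ N μ ∣ e μ (col μ l) := by
    have h1 : e μ = (W μ)⁻¹ *ᵥ (W μ *ᵥ e μ) := by
      rw [mulVec_mulVec, nonsing_inv_mul _ (hW μ), one_mulVec]
    rw [h1, mulVec, dotProduct]
    exact Finset.dvd_sum fun i _ => (hdvd i).mul_left _
  have h2 : e μ (col μ l) = c ⟨μ, l⟩ * p μ ^ (N μ - k ⟨μ, l⟩) := by
    simp only [e]
    rw [Finset.sum_eq_single l]
    · simp
    · intro b _ hb
      exact if_neg fun h => hb (hcol μ h).symm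
    · simp
  rw [h2] at hdvd'
  have h3 : p μ ^ N μ = p μ ^ k ⟨μ, l⟩ * p μ ^ (N μ - k ⟨μ, l⟩) := by
    rw [← pow_add, Nat.add_sub_cancel' (hk μ l)]
  rw [h3] at hdvd'
  exact (mul_dvd_mul_iff_right (pow_ne_zero _ (hp μ))).1 hdvd'

theorem SmithMcMillan.apply_eq {q t : ℕ} {p : K[X]} {T : Matrix (Fin q) (Fin t) (RatFunc K)}
    (S : SmithMcMillan p T) (i : Fin q) (j : Fin t) :
    T i j = ∑ l, toRat (S.u l i) * (toRat (S.a l) / toRat (p ^ S.k l)) * toRat (S.v l j) := by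
  have hD : ∀ (x : Fin q) (y : Fin t),
      (if h : (x : ℕ) = y ∧ (x : ℕ) < S.r then
        toRat (S.a ⟨x, h.2⟩) / toRat (p ^ S.k ⟨x, h.2⟩) else 0) =
      ∑ l : Fin S.r, if x = Fin.castLE S.r_le_rows l then
        if y = Fin.castLE S.r_le_cols l then toRat (S.a l) / toRat (p ^ S.k l) else 0 else 0 := by
    intro x y
    split_ifs with h
    · rw [Finset.sum_eq_single ⟨x, h.2⟩]
      · have h1 : x = Fin.castLE S.r_le_rows ⟨x, h.2⟩ := Fin.ext rfl
        have h2 : y = Fin.castLE S.r_le_cols ⟨x, h.2⟩ := Fin.ext h.1.symm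
        rw [if_pos h1, if_pos h2]
      · intro b _ hb
        have h1 : ¬ x = Fin.castLE S.r_le_rows b := fun hx =>
          hb (Fin.ext (congrArg Fin.val hx).symm)
        rw [if_neg h1]
      · simp
    · symm
      refine Finset.sum_eq_zero fun l _ => ?_
      split_ifs with h1 h2
      · exact absurd ⟨by rw [h1, h2]; rfl, by rw [h1]; exact l.2⟩ h
      · rfl
      · rfl
  conv_lhs => rw [S.factorization]
  simp only [mul_apply, of_apply, hD, Matrix.map_apply, transpose_apply, Finset.mul_sum,
    Finset.sum_mul]
  have h1 : ∀ y : Fin t, (∑ x : Fin q, ∑ l : Fin S.r,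
      toRat (S.U i x) * (if x = Fin.castLE S.r_le_rows l then
        if y = Fin.castLE S.r_le_cols l then toRat (S.a l) / toRat (p ^ S.k l) else 0 else 0) *
        toRat (S.V j y)) = ∑ l : Fin S.r, toRat (S.U i (Fin.castLE S.r_le_rows l)) *
        (if y = Fin.castLE S.r_le_cols l then toRat (S.a l) / toRat (p ^ S.k l) else 0) *
        toRat (S.V j y) := by
    intro y
    rw [Finset.sum_comm]
    refine Finset.sum_congr rfl fun l _ => ?_
    rw [Finset.sum_eq_single (Fin.castLE S.r_le_rows l)]
    · rw [if_pos rfl]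
    · intro b _ hb
      rw [if_neg hb, mul_zero, zero_mul]
    · simp
  simp only [h1]
  rw [Finset.sum_comm]
  refine Finset.sum_congr rfl fun l _ => ?_
  rw [Finset.sum_eq_single (Fin.castLE S.r_le_cols l)]
  · rw [if_pos rfl]; rfl
  · intro b _ hb
    rw [if_neg hb, mul_zero, zero_mul]
  · simp

/-! ### The realization and its minimality -/

namespace Procedure

variable {q t : ℕ} {T : Matrix (Fin q) (Fin t) (RatFunc K)} (P : Procedure T)

theorem prime_monic (x : P.Block) : (P.prime x).Monic := P.p_monic _

theorem prime_natDegree_pos (x : P.Block) : 0 < (P.prime x).natDegree :=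
  (P.p_irreducible x.1).natDegree_pos

theorem pairwise_isCoprime : Pairwise fun μ ν => IsCoprime (P.p μ) (P.p ν) := by
  intro μ ν h
  rw [(P.p_irreducible μ).coprime_iff_not_dvd]
  intro hd
  have := (P.p_irreducible μ).associated_of_dvd (P.p_irreducible ν) hd
  exact h (P.p_injective (eq_of_monic_of_associated (P.p_monic μ) (P.p_monic ν) this))

theorem exists_a_eq (x : P.Block) :
    ∃ y, (P.smith x.1).a x.2 = P.atilde x.1 x.2 + P.prime x ^ P.exponent x * y := by
  obtain ⟨-, y, hy⟩ := P.atilde_spec x.1 x.2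
  refine ⟨y, toRat_injective ?_⟩
  have hne := toRat_ne_zero (pow_ne_zero ((P.smith x.1).k x.2) (P.p_monic x.1).ne_zero)
  rw [div_eq_iff hne, add_mul, div_mul_cancel₀ _ hne] at hy
  rw [hy, toRat_add, toRat_mul, mul_comm (toRat y)]
  rfl

theorem pow_dvd_of_pow_dvd_atilde_mul (x : P.Block) {f : K[X]}
    (h : P.prime x ^ P.exponent x ∣ P.atilde x.1 x.2 * f) : P.prime x ^ P.exponent x ∣ f := by
  -- For exponent 0 one has ã = 0, which is not coprime to p, but then the divisor is 1. Otherwise ã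
  -- ≡ a modulo p inherits coprimality from a.
  rcases Nat.eq_zero_or_pos (P.exponent x) with h0 | h0
  · rw [h0, pow_zero]; exact one_dvd f
  · obtain ⟨y, hy⟩ := P.exists_a_eq x
    have hc : IsCoprime (P.prime x) ((P.smith x.1).a x.2) := (P.smith x.1).coprime x.2
    obtain ⟨e, he⟩ := Nat.exists_eq_add_of_lt h0
    rw [hy, he, zero_add, pow_succ', mul_assoc, IsCoprime.add_mul_left_right_iff] at hc
    exact hc.pow_left.dvd_of_dvd_mul_left h

theorem isStrictlyProper_apply (P : Procedure T) (i : Fin q) (j : Fin t) :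
    IsStrictlyProper (T i j) := by
  rw [P.part_sum, Matrix.sum_apply]
  exact IsStrictlyProper.sum _ fun μ _ => P.part_proper μ i j

/-- Both sides equal the same sum of rank one terms modulo polynomials, as replacing a by ã changes
a term by a polynomial; and both are strictly proper. -/
theorem realization : T = P.H.map RatFunc.C * matResolvent P.F * P.G.map RatFunc.C := by
  ext i j
  obtain ⟨y, hy⟩ := jacobsonDiag_pairing P.prime P.exponent P.prime_monic P.prime_natDegree_pos
    (fun x => (P.smith x.1).u x.2 i * P.atilde x.1 x.2) (fun x => (P.smith x.1).v x.2 j)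
  have hH : (P.H.map RatFunc.C * matResolvent P.F * P.G.map RatFunc.C) i j =
      ∑ x : P.Block, toRat ((P.smith x.1).u x.2 i * P.atilde x.1 x.2 * (P.smith x.1).v x.2 j) /
        toRat (P.prime x ^ P.exponent x) + toRat y := by
    rw [← hy, Matrix.mul_assoc]
    rfl
  choose z hz using P.exists_a_eq
  have hT : T i j =
      ∑ x : P.Block, toRat ((P.smith x.1).u x.2 i * P.atilde x.1 x.2 * (P.smith x.1).v x.2 j) /
        toRat (P.prime x ^ P.exponent x) +
      toRat (∑ x : P.Block, (P.smith x.1).u x.2 i * z x * (P.smith x.1).v x.2 j) := by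
    conv_lhs => rw [P.part_sum]
    rw [Matrix.sum_apply, toRat_sum, ← Finset.sum_add_distrib, Fintype.sum_sigma]
    refine Finset.sum_congr rfl fun μ _ => ?_
    rw [(P.smith μ).apply_eq]
    refine Finset.sum_congr rfl fun l _ => ?_
    have hne := toRat_ne_zero (pow_ne_zero ((P.smith μ).k l) (P.p_monic μ).ne_zero)
    have hzx := hz ⟨μ, l⟩
    simp only [prime, exponent] at hzx ⊢
    rw [hzx]
    simp only [toRat_mul, toRat_add]
    field_simp
  have hsp : IsStrictlyProper (T i j -
      (P.H.map RatFunc.C * matResolvent P.F * P.G.map RatFunc.C) i j) :=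
    (P.isStrictlyProper_apply i j).sub (isStrictlyProper_mul_const _
      (isStrictlyProper_const_mul _ (isStrictlyProper_matResolvent P.F)) i j)
  rw [← sub_eq_zero]
  have hpoly : T i j - (P.H.map RatFunc.C * matResolvent P.F * P.G.map RatFunc.C) i j =
      toRat (∑ x : P.Block, (P.smith x.1).u x.2 i * z x * (P.smith x.1).v x.2 j - y) := by
    rw [hH, hT, toRat_sub]; ring
  rw [hpoly] at hsp ⊢
  rw [hsp.eq_zero_of_toRat, toRat_zero]

/-- The pair `(F, H)` is observable. -/
theorem observable (v : P.State → K)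
    (h : P.H.map RatFunc.C *ᵥ (matResolvent P.F *ᵥ fun z => RatFunc.C (v z)) = 0) : v = 0 := by
  choose f hf using fun x => exists_dualColumn_eq (k := P.exponent x) (P.prime_monic x)
    fun z => v ⟨x, z⟩
  have hv : ∀ z : P.State, v z = dualColumn (P.prime z.1) (P.exponent z.1) (f z.1) z.2 :=
    fun z => by rw [hf]
  -- Row i of the hypothesis says that the sum of the terms u ã f / pᵏ is a polynomial.
  have hd : ∀ x : P.Block, P.prime x ^ P.exponent x ∣ P.atilde x.1 x.2 * f x := by
    refine pow_dvd_of_unimodular_combination (fun μ => (P.p_monic μ).ne_zero)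
      P.pairwise_isCoprime (W := fun μ => (P.smith μ).U) (fun μ => (P.smith μ).unimodular_U)
      (col := fun μ => Fin.castLE (P.smith μ).r_le_rows)
      (fun μ => Fin.castLE_injective _) P.exponent _ fun i => ?_
    obtain ⟨y, hy⟩ := jacobsonDiag_pairing P.prime P.exponent P.prime_monic
      P.prime_natDegree_pos (fun x => (P.smith x.1).u x.2 i * P.atilde x.1 x.2) f
    simp only [← hv] at hy
    have h0 := (congrFun h i).symm.trans hy
    refine ⟨-y, ?_⟩
    rw [Pi.zero_apply] at h0
    have h1 := eq_neg_of_add_eq_zero_left h0.symm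
    rw [← zero_sub, toRat_sub, toRat_zero, zero_sub, ← h1]
    refine Finset.sum_congr rfl fun x _ => ?_
    rw [← mul_assoc]
    rfl
  ext z
  rw [hv, dualColumn_eq_zero_of_dvd _ (P.prime_monic z.1)
    (P.pow_dvd_of_pow_dvd_atilde_mul z.1 (hd z.1))]
  rfl

/-- The pair `(F, G)` is controllable. -/
theorem controllable (v : P.State → K)
    (h : ((fun z => RatFunc.C (v z)) ᵥ* matResolvent P.F) ᵥ* P.G.map RatFunc.C = 0) : v = 0 := by
  choose f hf using fun x => exists_digitRow_eq (k := P.exponent x) (P.prime_monic x)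
    fun z => v ⟨x, z⟩
  have hv : ∀ z : P.State, v z = digitRow (P.prime z.1) (P.exponent z.1) (f z.1) z.2 :=
    fun z => by rw [hf]
  -- Here V replaces U, and no factor ã occurs because it was placed on the H side.
  have hd : ∀ x : P.Block, P.prime x ^ P.exponent x ∣ f x := by
    refine pow_dvd_of_unimodular_combination (fun μ => (P.p_monic μ).ne_zero)
      P.pairwise_isCoprime (W := fun μ => (P.smith μ).V) (fun μ => (P.smith μ).unimodular_V)
      (col := fun μ => Fin.castLE (P.smith μ).r_le_cols)
      (fun μ => Fin.castLE_injective _) P.exponent _ fun j => ?_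
    obtain ⟨y, hy⟩ := jacobsonDiag_pairing P.prime P.exponent P.prime_monic
      P.prime_natDegree_pos f (fun x => (P.smith x.1).v x.2 j)
    simp only [← hv] at hy
    rw [dotProduct_mulVec] at hy
    have h0 := (congrFun h j).symm.trans hy
    refine ⟨-y, ?_⟩
    rw [Pi.zero_apply] at h0
    have h1 := eq_neg_of_add_eq_zero_left h0.symm
    rw [← zero_sub, toRat_sub, toRat_zero, zero_sub, ← h1]
    refine Finset.sum_congr rfl fun x _ => ?_
    rw [mul_comm (f x)]
    rfl
  ext z
  rw [hv, digitRow_eq_zero_of_dvd _ (P.prime_monic z.1) (hd z.1)]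
  rfl

end Procedure

/-! ### Similarity of A and F -/

section Similarity

variable {ℓ : ℕ} {A : Matrix (Fin ℓ) (Fin ℓ) K} (P : Procedure (matResolvent A))

/-- Inserting T = HRG into AT = sT - 1 and using FR = sR - 1 gives (AH - HF)RG = HG - 1, where R is
the resolvent of F. The left side is strictly proper and the right side constant, so both are zero.
-/
theorem Procedure.mul_H_sub : A * P.H = P.H * P.F ∧ P.H * P.G = 1 := by
  have hT := P.realization
  have hA := const_mul_matResolvent A
  have hF := const_mul_matResolvent P.F
  have key : (A * P.H - P.H * P.F).map RatFunc.C * matResolvent P.F * P.G.map RatFunc.C =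
      (P.H * P.G - 1).map RatFunc.C := by
    have e1 : (A * P.H - P.H * P.F).map RatFunc.C =
        A.map RatFunc.C * P.H.map RatFunc.C - P.H.map RatFunc.C * P.F.map RatFunc.C := by
      rw [Matrix.map_sub _ (map_sub _), Matrix.map_mul, Matrix.map_mul]
    have e2 : (P.H * P.G - 1).map RatFunc.C = P.H.map RatFunc.C * P.G.map RatFunc.C - 1 := by
      rw [Matrix.map_sub _ (map_sub _), Matrix.map_mul, Matrix.map_one _ (map_zero _) (map_one _)]
    rw [e1, e2, Matrix.sub_mul, Matrix.sub_mul]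
    have e3 : A.map RatFunc.C * P.H.map RatFunc.C * matResolvent P.F * P.G.map RatFunc.C =
        (RatFunc.X : RatFunc K) • matResolvent A - 1 := by
      rw [Matrix.mul_assoc, Matrix.mul_assoc, ← Matrix.mul_assoc (P.H.map RatFunc.C), ← hT, hA]
    have e4 : P.H.map RatFunc.C * P.F.map RatFunc.C * matResolvent P.F * P.G.map RatFunc.C =
        (RatFunc.X : RatFunc K) • matResolvent A - P.H.map RatFunc.C * P.G.map RatFunc.C := by
      rw [Matrix.mul_assoc (P.H.map RatFunc.C), hF, Matrix.mul_sub, Matrix.sub_mul, Matrix.mul_smul,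
        Matrix.smul_mul, ← hT, Matrix.mul_one]
    rw [e3, e4, sub_sub_sub_cancel_left]
  have hzero : (P.H * P.G - 1) = 0 := by
    ext i j
    have hsp : IsStrictlyProper (toRat (C ((P.H * P.G - 1 : Matrix (Fin ℓ) (Fin ℓ) K) i j))) := by
      rw [toRat_C]
      have := isStrictlyProper_mul_const P.G (isStrictlyProper_const_mul (A * P.H - P.H * P.F)
        (isStrictlyProper_matResolvent P.F)) i j
      rw [key] at this
      exact this
    exact C_eq_zero.1 hsp.eq_zero_of_toRat
  refine ⟨?_, sub_eq_zero.1 hzero⟩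
  rw [hzero, Matrix.map_zero _ (map_zero _)] at key
  rw [← sub_eq_zero]
  refine Matrix.ext fun i => congrFun (P.controllable ((A * P.H - P.H * P.F) i) ?_)
  exact congrFun key i

/-- From AH = HF the resolvents satisfy TH = HR, while T = HRG gives TH = HRGH. Thus HR annihilates
GH - 1, and observability applies to each column. -/
theorem Procedure.G_mul_H : P.G * P.H = 1 := by
  have hT := P.realization
  have hAH := P.mul_H_sub.1
  have h1 : matResolvent A * P.H.map RatFunc.C = P.H.map RatFunc.C * matResolvent P.F := by
    have h2 : P.H.map RatFunc.C * P.F.charmatrix.map toRat =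
        A.charmatrix.map toRat * P.H.map RatFunc.C := by
      rw [charmatrix_map_toRat, charmatrix_map_toRat, Matrix.mul_sub, Matrix.sub_mul, ← Matrix.map_mul,
        ← Matrix.map_mul, hAH]
      congr 1
      ext i j
      simp [mul_comm]
    calc matResolvent A * P.H.map RatFunc.C
        = matResolvent A * (P.H.map RatFunc.C * (P.F.charmatrix.map toRat * matResolvent P.F)) := by
          rw [charmatrix_mul_matResolvent, Matrix.mul_one]
      _ = P.H.map RatFunc.C * matResolvent P.F := by
          rw [← Matrix.mul_assoc (P.H.map _), h2, ← Matrix.mul_assoc, ← Matrix.mul_assoc,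
            matResolvent_mul_charmatrix, Matrix.one_mul]
  have key : P.H.map RatFunc.C * (matResolvent P.F * (P.G * P.H - 1).map RatFunc.C) = 0 := by
    rw [Matrix.map_sub _ (map_sub _), Matrix.map_mul, Matrix.map_one _ (map_zero _) (map_one _),
      Matrix.mul_sub, Matrix.mul_sub, Matrix.mul_one, ← h1]
    have h3 := congrArg (fun M => M * P.H.map RatFunc.C) hT
    simp only [Matrix.mul_assoc] at h3
    rw [h3, sub_self]
  rw [← sub_eq_zero]
  refine Matrix.ext fun i j => congrFun
    (P.observable (fun i => (P.G * P.H - 1 : Matrix P.State P.State K) i j) ?_) i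
  ext i
  exact congrFun (congrFun key i) j

end Similarity

/-! ### Unimodular equivalence -/

section UnimodularEquiv

variable {R : Type*} [CommRing R] {n : Type*} [Fintype n] [DecidableEq n]

/-- Equivalence of square matrices under multiplication by unimodular matrices. -/
def UnimodularEquiv (M N : Matrix n n R) : Prop :=
  ∃ U V : Matrix n n R, IsUnit U.det ∧ IsUnit V.det ∧ M = U * N * V

theorem UnimodularEquiv.refl (M : Matrix n n R) : UnimodularEquiv M M :=
  ⟨1, 1, by simp, by simp, by simp⟩

theorem UnimodularEquiv.trans {M N L : Matrix n n R} (h₁ : UnimodularEquiv M N)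
    (h₂ : UnimodularEquiv N L) : UnimodularEquiv M L := by
  obtain ⟨U, V, hU, hV, rfl⟩ := h₁
  obtain ⟨U', V', hU', hV', rfl⟩ := h₂
  refine ⟨U * U', V' * V, ?_, ?_, by simp only [Matrix.mul_assoc]⟩
  · rw [det_mul]; exact hU.mul hU'
  · rw [det_mul]; exact hV'.mul hV

theorem UnimodularEquiv.symm {M N : Matrix n n R} (h : UnimodularEquiv M N) :
    UnimodularEquiv N M := by
  obtain ⟨U, V, hU, hV, rfl⟩ := h
  refine ⟨U⁻¹, V⁻¹, isUnit_nonsing_inv_det _ hU, isUnit_nonsing_inv_det _ hV, ?_⟩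
  rw [← Matrix.mul_assoc, ← Matrix.mul_assoc, nonsing_inv_mul _ hU, Matrix.one_mul,
    Matrix.mul_assoc, mul_nonsing_inv _ hV, Matrix.mul_one]

theorem UnimodularEquiv.submatrix {m : Type*} [Fintype m] [DecidableEq m] {M N : Matrix n n R}
    (h : UnimodularEquiv M N) (e : m ≃ n) :
    UnimodularEquiv (M.submatrix e e) (N.submatrix e e) := by
  obtain ⟨U, V, hU, hV, rfl⟩ := h
  refine ⟨U.submatrix e e, V.submatrix e e, ?_, ?_, ?_⟩
  · rwa [det_submatrix_equiv_self]
  · rwa [det_submatrix_equiv_self]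
  · rw [submatrix_mul_equiv, submatrix_mul_equiv]

theorem unimodularEquiv_submatrix_perm (M : Matrix n n R) (σ τ : Equiv.Perm n) :
    UnimodularEquiv M (M.submatrix σ τ) := by
  refine ⟨(1 : Matrix n n R).submatrix id σ, (1 : Matrix n n R).submatrix τ id, ?_, ?_, ?_⟩
  · refine isUnit_det_of_right_inverse (B := (1 : Matrix n n R).submatrix σ id) ?_
    rw [submatrix_mul_equiv]; simp
  · refine isUnit_det_of_left_inverse (B := (1 : Matrix n n R).submatrix id τ) ?_
    rw [submatrix_mul_equiv]; simp
  · rw [submatrix_mul_equiv, submatrix_mul_equiv]; simp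

/-- The identity matrix with the rows and columns `i`, `j` replaced by a `2 × 2` matrix. -/
def pairMatrix (i j : n) (a b c d : R) : Matrix n n R :=
  Matrix.of fun r s =>
    if r = i then (if s = i then a else if s = j then b else 0)
    else if r = j then (if s = i then c else if s = j then d else 0)
    else if r = s then 1 else 0

variable {i j : n}

theorem pairMatrix_mul_apply (hij : i ≠ j) (a b c d : R) (N : Matrix n n R) (r t : n) :
    (pairMatrix i j a b c d * N) r t =
      if r = i then a * N i t + b * N j t
      else if r = j then c * N i t + d * N j t else N r t := by
  have key : ∀ u v : R, ∑ s, (if s = i then u else if s = j then v else 0) * N s t =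
      u * N i t + v * N j t := by
    intro u v
    rw [Fintype.sum_eq_add i j hij]
    · simp [hij.symm]
    · intro x hx; simp [hx.1, hx.2]
  simp only [pairMatrix, mul_apply, of_apply]
  split_ifs with h1 h2
  · exact key a b
  · exact key c d
  · simp

theorem mul_pairMatrix_apply (hij : i ≠ j) (a b c d : R) (N : Matrix n n R) (t s : n) :
    (N * pairMatrix i j a b c d) t s =
      if s = i then N t i * a + N t j * c
      else if s = j then N t i * b + N t j * d else N t s := by
  have h : (pairMatrix i j a b c d)ᵀ = pairMatrix i j a c b d := by
    ext r s
    simp only [pairMatrix, transpose_apply, of_apply]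
    by_cases h1 : r = i
    · subst h1
      by_cases h2 : s = r
      · simp [h2]
      · by_cases h3 : s = j
        · simp [h3, hij.symm]
        · simp [h2, h3]
    · by_cases h2 : s = i
      · subst h2; simp [h1]
      · by_cases h3 : r = j
        · subst h3
          by_cases h4 : s = r <;> simp [h1, h2, h4]
        · by_cases h4 : s = j
          · simp [h1, h3, h4, hij.symm]
          · simp [h1, h2, h3, h4, eq_comm]
  have h2 := pairMatrix_mul_apply hij a c b d Nᵀ s t
  rw [← h, ← transpose_mul, transpose_apply] at h2
  rw [h2]
  simp only [transpose_apply, mul_comm]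

theorem isUnit_det_pairMatrix (hij : i ≠ j) {a b c d : R} (h : a * d - b * c = 1) :
    IsUnit (pairMatrix i j a b c d).det := by
  refine isUnit_det_of_right_inverse (B := pairMatrix i j d (-b) (-c) a) ?_
  ext r s
  rw [pairMatrix_mul_apply hij]
  by_cases h1 : r = i
  · subst h1
    by_cases h2 : s = r
    · subst h2; simp [pairMatrix, hij.symm]; linear_combination h
    · by_cases h3 : s = j
      · subst h3; simp [pairMatrix, hij, hij.symm]; ring
      · simp [pairMatrix, h2, h3, hij.symm, Ne.symm h2]
  · by_cases h2 : r = j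
    · subst h2
      by_cases h3 : s = i
      · subst h3; simp [pairMatrix, h1]; ring
      · by_cases h4 : s = r
        · subst h4; simp [pairMatrix, h1]; linear_combination h
        · simp [pairMatrix, h1, h3, h4, Ne.symm h4]
    · simp [pairMatrix, h1, h2, one_apply]

/-- The gcd–lcm exchange: with a x + b y = 1, the rows (x, y), (-b, a) on the left and (1, -yb), (1,
xa) on the right have determinant 1 and carry diag(ga, gb) to diag(g, gab). -/
theorem unimodularEquiv_diagonal_swap (hij : i ≠ j) {f : n → R} {g a b x y : R}
    (hi : f i = g * a) (hj : f j = g * b) (hxy : a * x + b * y = 1) :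
    UnimodularEquiv (diagonal f)
      (diagonal (Function.update (Function.update f i g) j (g * a * b))) := by
  refine UnimodularEquiv.symm ⟨pairMatrix i j x y (-b) a, pairMatrix i j 1 (-(y * b)) 1 (x * a),
    isUnit_det_pairMatrix hij (by linear_combination hxy),
    isUnit_det_pairMatrix hij (by linear_combination hxy), ?_⟩
  ext r s
  rw [mul_pairMatrix_apply hij]
  simp only [pairMatrix_mul_apply hij]
  have hji := hij.symm
  by_cases h1 : r = i
  · subst h1
    by_cases h2 : s = r
    · subst h2; simp [hij, hji, hi, hj]; linear_combination -g * hxy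
    · by_cases h3 : s = j
      · subst h3; simp [hij, hji, hi, hj]; ring
      · simp [h2, h3, Ne.symm h2, Ne.symm h3, diagonal_apply_ne]
  · by_cases h2 : r = j
    · subst h2
      by_cases h3 : s = i
      · subst h3; simp [hij, hji, hi, hj]; ring
      · by_cases h4 : s = r
        · subst h4; simp [hij, hji, hi, hj]; linear_combination -(g * a * b) * hxy
        · simp [hji, h3, h4, Ne.symm h3, Ne.symm h4, diagonal_apply_ne]
    · by_cases h3 : s = i
      · subst h3; simp [h1, h2]
      · by_cases h4 : s = j
        · subst h4; simp [h1, h2]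
        · by_cases h5 : r = s
          · subst h5; simp [h1, h2]
          · simp [h1, h2, h3, h4, h5]

end UnimodularEquiv

/-! ### Diagonalization of polynomial matrices -/

theorem exists_bezout (a b : K[X]) (ha : a ≠ 0) :
    ∃ g a' b' x y : K[X], a = g * a' ∧ b = g * b' ∧ a' * x + b' * y = 1 := by
  classical
  obtain ⟨a', ha'⟩ := EuclideanDomain.gcd_dvd_left a b
  obtain ⟨b', hb'⟩ := EuclideanDomain.gcd_dvd_right a b
  have hg := EuclideanDomain.gcd_eq_gcd_ab a b
  set g := EuclideanDomain.gcd a b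
  have hg0 : g ≠ 0 := by rintro h; rw [h, zero_mul] at ha'; exact ha ha'
  refine ⟨g, a', b', EuclideanDomain.gcdA a b, EuclideanDomain.gcdB a b, ha', hb', ?_⟩
  apply mul_left_cancel₀ hg0
  calc g * (a' * EuclideanDomain.gcdA a b + b' * EuclideanDomain.gcdB a b)
      = (g * a') * EuclideanDomain.gcdA a b + (g * b') * EuclideanDomain.gcdB a b := by ring
    _ = g * 1 := by rw [← ha', ← hb', ← hg, mul_one]

theorem natDegree_lt_of_eq_mul {a b g a' b' : K[X]} (ha0 : a ≠ 0) (ha : a = g * a')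
    (hb : b = g * b') (h : ¬ a ∣ b) : g.natDegree < a.natDegree := by
  have hg0 : g ≠ 0 := by rintro rfl; rw [zero_mul] at ha; exact ha0 ha
  have ha'0 : a' ≠ 0 := by rintro rfl; rw [mul_zero] at ha; exact ha0 ha
  rw [ha, natDegree_mul hg0 ha'0]
  by_contra hlt
  have hd : a'.natDegree = 0 := by omega
  have hu : IsUnit a' := by
    rw [isUnit_iff_degree_eq_zero, degree_eq_natDegree ha'0, hd]; rfl
  apply h
  rw [ha, hb]
  exact mul_dvd_mul_left g hu.dvd

/-- Take an equivalent matrix whose corner entry is nonzero of least degree. An entry in its row or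
column that it does not divide would give, by a Bézout step, a corner entry of smaller degree. -/
theorem exists_unimodularEquiv_dvd_row_col {n : Type*} [Fintype n] [DecidableEq n] (x₀ : n)
    {M : Matrix n n K[X]} (hM : M ≠ 0) :
    ∃ N, UnimodularEquiv M N ∧ (∀ i, N x₀ x₀ ∣ N i x₀) ∧ ∀ j, N x₀ x₀ ∣ N x₀ j := by
  have hne : {N | UnimodularEquiv M N ∧ N x₀ x₀ ≠ 0}.Nonempty := by
    have : ∃ i j, M i j ≠ 0 := by
      by_contra! h
      exact hM (Matrix.ext h)
    obtain ⟨i, j, hij⟩ := this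
    refine ⟨M.submatrix (Equiv.swap x₀ i) (Equiv.swap x₀ j),
      unimodularEquiv_submatrix_perm _ _ _, ?_⟩
    simpa using hij
  obtain ⟨N, ⟨hMN, hN0⟩, hmin⟩ :=
    WellFounded.has_min (measure fun N : Matrix n n K[X] => (N x₀ x₀).natDegree).wf _ hne
  refine ⟨N, hMN, fun i => ?_, fun j => ?_⟩
  · by_contra hd
    have hi : x₀ ≠ i := by rintro rfl; exact hd dvd_rfl
    obtain ⟨g, a, b, x, y, ha, hb, hxy⟩ := exists_bezout (N x₀ x₀) (N i x₀) hN0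
    have hu := isUnit_det_pairMatrix hi (a := x) (b := y) (c := -b) (d := a)
      (by linear_combination hxy)
    have hentry : (pairMatrix x₀ i x y (-b) a * N) x₀ x₀ = g := by
      rw [pairMatrix_mul_apply hi, if_pos rfl, ha, hb]; linear_combination g * hxy
    refine hmin (pairMatrix x₀ i x y (-b) a * N) ⟨hMN.trans (UnimodularEquiv.symm
      ⟨_, 1, hu, by simp, by rw [Matrix.mul_one]⟩), ?_⟩ ?_
    · rw [hentry]; rintro rfl; rw [zero_mul] at ha; exact hN0 ha
    · change ((pairMatrix x₀ i x y (-b) a * N) x₀ x₀).natDegree < _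
      rw [hentry]; exact natDegree_lt_of_eq_mul hN0 ha hb hd
  · by_contra hd
    have hj : x₀ ≠ j := by rintro rfl; exact hd dvd_rfl
    obtain ⟨g, a, b, x, y, ha, hb, hxy⟩ := exists_bezout (N x₀ x₀) (N x₀ j) hN0
    have hu := isUnit_det_pairMatrix hj (a := x) (b := -b) (c := y) (d := a)
      (by linear_combination hxy)
    have hentry : (N * pairMatrix x₀ j x (-b) y a) x₀ x₀ = g := by
      rw [mul_pairMatrix_apply hj, if_pos rfl, ha, hb]; linear_combination g * hxy
    refine hmin (N * pairMatrix x₀ j x (-b) y a) ⟨hMN.trans (UnimodularEquiv.symm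
      ⟨1, _, by simp, hu, by rw [Matrix.one_mul]⟩), ?_⟩ ?_
    · rw [hentry]; rintro rfl; rw [zero_mul] at ha; exact hN0 ha
    · change ((N * pairMatrix x₀ j x (-b) y a) x₀ x₀).natDegree < _
      rw [hentry]; exact natDegree_lt_of_eq_mul hN0 ha hb hd

theorem exists_unimodularEquiv_diagonal (n : ℕ) (M : Matrix (Fin n) (Fin n) K[X]) :
    ∃ d, UnimodularEquiv M (diagonal d) := by
  induction n with
  | zero => exact ⟨0, 1, 1, by simp, by simp, Subsingleton.elim _ _⟩
  | succ n ih =>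
    by_cases hM : M = 0
    · refine ⟨0, ?_⟩
      rw [hM, diagonal_zero']
      exact UnimodularEquiv.refl _
    let e : Unit ⊕ Fin n ≃ Fin (n + 1) := Fintype.equivOfCardEq (by simp [add_comm])
    suffices h : ∃ d, UnimodularEquiv (M.submatrix e e) (diagonal d) by
      obtain ⟨d, hd⟩ := h
      refine ⟨d ∘ e.symm, ?_⟩
      have := hd.submatrix e.symm
      simpa [submatrix_submatrix] using this
    have hM' : M.submatrix e e ≠ 0 := by
      intro h
      apply hM
      ext1 i j
      simpa using congrFun (congrFun h (e.symm i)) (e.symm j)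
    obtain ⟨N, hMN, hc, hr⟩ := exists_unimodularEquiv_dvd_row_col (Sum.inl ()) hM'
    choose γ hγ using fun i : Fin n => hc (Sum.inr i)
    choose β hβ using fun j : Fin n => hr (Sum.inr j)
    set a := N (Sum.inl ()) (Sum.inl ())
    let γ' : Matrix (Fin n) Unit K[X] := Matrix.of fun i _ => γ i
    let β' : Matrix Unit (Fin n) K[X] := Matrix.of fun _ j => β j
    let A : Matrix Unit Unit K[X] := diagonal fun _ => a
    -- The corner divides its row and column, so block elimination leaves its Schur complement,
    -- which the induction hypothesis diagonalizes.
    obtain ⟨d, U, V, hU, hV, hD⟩ := ih (N.toBlocks₂₂ - γ' * A * β')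
    have hN : N = fromBlocks A (A * β') (γ' * A) N.toBlocks₂₂ := by
      conv_lhs => rw [← fromBlocks_toBlocks N]
      congr 1
      · refine Matrix.ext fun i j => ?_
        rw [diagonal_mul]
        exact hβ j
      · refine Matrix.ext fun i j => ?_
        rw [mul_diagonal, mul_comm]
        exact hγ i
    refine ⟨Sum.elim (fun _ => a) d, hMN.trans
      ⟨fromBlocks 1 0 γ' U, fromBlocks 1 β' 0 V, ?_, ?_, ?_⟩⟩
    · rw [det_fromBlocks_zero₁₂, det_one, one_mul]; exact hU
    · rw [det_fromBlocks_zero₂₁, det_one, one_mul]; exact hV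
    · rw [← fromBlocks_diagonal, fromBlocks_multiply, fromBlocks_multiply]
      conv_lhs => rw [hN, ← sub_add_cancel N.toBlocks₂₂ (γ' * A * β'), hD]
      congr 1 <;> simp [A, add_comm]

/-! ### Prime power factors and divisibility chains -/

section PrimePowerFactors

theorem sum_singleton_eq_map {α β : Type*} (s : Finset α) (φ : α → β) :
    ∑ x ∈ s, ({φ x} : Multiset β) = s.val.map φ := by
  rw [Finset.sum_eq_multiset_sum, ← Multiset.sum_map_singleton (s.val.map φ), Multiset.map_map]
  rfl

theorem sum_eq_add_add_sum_erase_erase {α M : Type*} [Fintype α] [DecidableEq α]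
    [AddCommMonoid M] {i j : α} (hij : i ≠ j) (φ : α → M) :
    ∑ r, φ r = φ i + φ j + ∑ r ∈ (Finset.univ.erase i).erase j, φ r := by
  rw [add_assoc, Finset.add_sum_erase _ _ (Finset.mem_erase.2 ⟨hij.symm, Finset.mem_univ j⟩),
    Finset.add_sum_erase _ _ (Finset.mem_univ i)]

/-- The contribution of an irreducible `q` of multiplicity `c` to the prime power factors. -/
noncomputable def powSingleton (q : K[X]) (c : ℕ) : Multiset K[X] := if c = 0 then 0 else {q ^ c}

open Classical in
theorem primePowerFactors_eq_sum {f : K[X]} {s : Finset K[X]}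
    (hs : (normalizedFactors f).toFinset ⊆ s) :
    primePowerFactors f = ∑ q ∈ s, powSingleton q ((normalizedFactors f).count q) := by
  have h : primePowerFactors f =
      ∑ q ∈ (normalizedFactors f).toFinset, powSingleton q ((normalizedFactors f).count q) := by
    rw [primePowerFactors, ← sum_singleton_eq_map]
    refine Finset.sum_congr rfl fun q hq => ?_
    rw [Multiset.mem_toFinset] at hq
    exact (if_neg (Multiset.count_ne_zero.2 hq)).symm
  rw [h]
  refine Finset.sum_subset hs fun q _ hq => ?_
  rw [Multiset.mem_toFinset] at hq
  simp [powSingleton, Multiset.count_eq_zero_of_notMem hq]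

theorem primePowerFactors_congr {f g : K[X]} (h : Associated f g) :
    primePowerFactors f = primePowerFactors g := by
  classical
  unfold primePowerFactors
  rw [h.normalizedFactors_eq]

theorem primePowerFactors_one : primePowerFactors (1 : K[X]) = 0 := by
  simp [primePowerFactors, normalizedFactors_one]

theorem primePowerFactors_pow {p : K[X]} (hp : Irreducible p) (hm : p.Monic) {k : ℕ} (hk : 0 < k) :
    primePowerFactors (p ^ k) = {p ^ k} := by
  classical
  have h : normalizedFactors (p ^ k) = Multiset.replicate k p := by
    rw [normalizedFactors_of_irreducible_pow hp, hm.normalize_eq_self]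
  rw [primePowerFactors, h, Multiset.toFinset_replicate, if_neg hk.ne']
  simp

/-- An irreducible factor divides at most one of a and b, so its exponents in g and gab are those in
ga and gb, possibly exchanged. -/
theorem primePowerFactors_gcd_lcm {g a b : K[X]} (hg : g ≠ 0) (ha : a ≠ 0) (hb : b ≠ 0)
    (hab : IsCoprime a b) :
    primePowerFactors g + primePowerFactors (g * a * b) =
      primePowerFactors (g * a) + primePowerFactors (g * b) := by
  classical
  have h1 := normalizedFactors_mul hg ha
  have h2 := normalizedFactors_mul hg hb
  have h3 := normalizedFactors_mul (mul_ne_zero hg ha) hb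
  set s := (normalizedFactors (g * a * b)).toFinset with hs
  have sub : ∀ f, f ∣ g * a * b → (normalizedFactors f).toFinset ⊆ s := by
    intro f hf
    have hf0 : f ≠ 0 := ne_zero_of_dvd_ne_zero (mul_ne_zero (mul_ne_zero hg ha) hb) hf
    exact Multiset.toFinset_subset.2 (Multiset.subset_of_le
      ((dvd_iff_normalizedFactors_le_normalizedFactors hf0
        (mul_ne_zero (mul_ne_zero hg ha) hb)).1 hf))
  rw [primePowerFactors_eq_sum (sub g ⟨a * b, by ring⟩), primePowerFactors_eq_sum (sub _ dvd_rfl),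
    primePowerFactors_eq_sum (sub (g * a) ⟨b, by ring⟩),
    primePowerFactors_eq_sum (sub (g * b) ⟨a, by ring⟩), ← Finset.sum_add_distrib,
    ← Finset.sum_add_distrib]
  refine Finset.sum_congr rfl fun q _ => ?_
  rw [h3, h1, h2]
  simp only [Multiset.count_add]
  have h0 : (normalizedFactors a).count q = 0 ∨ (normalizedFactors b).count q = 0 := by
    by_contra! h
    have h4 := Multiset.count_ne_zero.1 h.1
    have h5 := Multiset.count_ne_zero.1 h.2
    exact (irreducible_of_normalized_factor q h4).not_isUnit
      (hab.isUnit_of_dvd' (dvd_of_mem_normalizedFactors h4) (dvd_of_mem_normalizedFactors h5))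
  rcases h0 with h0 | h0
  · simp [h0]
  · simp [h0, add_comm]

/-- Minimize the sum of (n - i) deg d_i. If d_i = ga does not divide d_j with i < j, the gcd–lcm
exchange moves the positive degree of a from position i to the lighter position j, contradicting
minimality. -/
theorem exists_divisibility_chain {n : ℕ} (f : Fin n → K[X]) (hf : ∀ i, f i ≠ 0) :
    ∃ d : Fin n → K[X], UnimodularEquiv (diagonal f) (diagonal d) ∧ (∀ i, (d i).Monic) ∧
      (∀ i j, i ≤ j → d i ∣ d j) ∧
      ∑ i, primePowerFactors (f i) = ∑ i, primePowerFactors (d i) := by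
  let S : Set (Fin n → K[X]) := {d | UnimodularEquiv (diagonal f) (diagonal d) ∧ (∀ i, d i ≠ 0) ∧
    ∑ i, primePowerFactors (f i) = ∑ i, primePowerFactors (d i)}
  have hS : S.Nonempty := ⟨f, UnimodularEquiv.refl _, hf, rfl⟩
  obtain ⟨d, ⟨h1, h2, h3⟩, hmin⟩ := WellFounded.has_min
    (measure fun d : Fin n → K[X] => ∑ i : Fin n, (n - (i : ℕ)) * (d i).natDegree).wf S hS
  have hchain : ∀ i j, i < j → d i ∣ d j := by
    intro i j hij
    by_contra hd
    obtain ⟨g, a, b, x, y, ha, hb, hxy⟩ := exists_bezout (d i) (d j) (h2 i)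
    have hlt := natDegree_lt_of_eq_mul (h2 i) ha hb hd
    have hi0 := h2 i
    have hj0 := h2 j
    rw [ha] at hi0
    rw [hb] at hj0
    have hg0 := left_ne_zero_of_mul hi0
    have ha0 := right_ne_zero_of_mul hi0
    have hb0 := right_ne_zero_of_mul hj0
    set d' := Function.update (Function.update d i g) j (g * a * b) with hd'
    have e1 : d' i = g := by simp [hd', hij.ne]
    have e2 : d' j = g * a * b := by simp [hd']
    have e3 : ∀ r, r ≠ i → r ≠ j → d' r = d r := fun r hri hrj => by simp [hd', hri, hrj]
    have e4 : ∀ r ∈ (Finset.univ.erase i).erase j, d' r = d r := by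
      intro r hr
      rw [Finset.mem_erase, Finset.mem_erase] at hr
      exact e3 r hr.2.1 hr.1
    refine hmin d' ⟨h1.trans (unimodularEquiv_diagonal_swap hij.ne ha hb hxy), ?_, ?_⟩ ?_
    · intro r
      by_cases hri : r = i
      · rw [hri, e1]; exact hg0
      by_cases hrj : r = j
      · rw [hrj, e2]; exact mul_ne_zero hi0 hb0
      rw [e3 r hri hrj]; exact h2 r
    · rw [h3, sum_eq_add_add_sum_erase_erase hij.ne,
        sum_eq_add_add_sum_erase_erase hij.ne (fun r => primePowerFactors (d' r)),
        Finset.sum_congr rfl fun r hr => congrArg primePowerFactors (e4 r hr), e1, e2,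
        primePowerFactors_gcd_lcm hg0 ha0 hb0 ⟨x, y, by linear_combination hxy⟩, ha, hb]
    · change ∑ r : Fin n, (n - (r : ℕ)) * (d' r).natDegree <
        ∑ r : Fin n, (n - (r : ℕ)) * (d r).natDegree
      rw [sum_eq_add_add_sum_erase_erase hij.ne,
        sum_eq_add_add_sum_erase_erase hij.ne (fun r : Fin n => (n - (r : ℕ)) * (d r).natDegree),
        Finset.sum_congr rfl fun (r : Fin n) hr =>
          congrArg (fun f : K[X] => (n - (r : ℕ)) * f.natDegree) (e4 r hr), e1, e2]
      refine Nat.add_lt_add_right ?_ _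
      rw [ha, natDegree_mul hg0 ha0] at hlt ⊢
      rw [hb, natDegree_mul hi0 hb0, natDegree_mul hg0 ha0, natDegree_mul hg0 hb0]
      have hjn := j.2
      have hij' : (i : ℕ) < j := hij
      obtain ⟨u, hu⟩ : ∃ u, n - (i : ℕ) = (n - (j : ℕ)) + (u + 1) := ⟨j - i - 1, by omega⟩
      rw [hu]
      have : 0 < a.natDegree := by omega
      nlinarith [Nat.mul_pos (Nat.succ_pos u) this]
  have hunit : ∀ i, IsUnit (C (d i).leadingCoeff⁻¹) := fun i =>
    isUnit_C.2 (inv_ne_zero (leadingCoeff_ne_zero.2 (h2 i))).isUnit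
  refine ⟨fun i => d i * C (d i).leadingCoeff⁻¹, h1.trans (UnimodularEquiv.symm
    ⟨1, diagonal fun i => C (d i).leadingCoeff⁻¹, by simp, ?_, ?_⟩), ?_, ?_, ?_⟩
  · rw [det_diagonal, IsUnit.prod_univ_iff]; exact hunit
  · rw [Matrix.one_mul, diagonal_mul_diagonal]
  · exact fun i => monic_mul_leadingCoeff_inv (h2 i)
  · intro i j hij
    refine (hunit i).mul_right_dvd.2 (Dvd.dvd.mul_right ?_ _)
    rcases hij.eq_or_lt with rfl | h
    · exact dvd_rfl
    · exact hchain i j h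
  · rw [h3]
    exact Finset.sum_congr rfl fun i _ => primePowerFactors_congr
      (associated_mul_unit_right _ _ (hunit i))

end PrimePowerFactors

/-! ### The Smith form of a Jacobson matrix -/

/-- Replace the first column of the identity by the vector pⁱ sᶜ to get Q, of determinant 1. Then
(sI - J)Q has pᵏ e_last as first column, so pᵏ can be split off, leaving Z. -/
theorem unimodularEquiv_charmatrix_jacobsonBlock {p : K[X]} (hp : p.Monic)
    (hn : 0 < p.natDegree) (k : ℕ) :
    UnimodularEquiv (jacobsonBlock p k).charmatrix
      (diagonal fun x => if (x.1 : ℕ) = 0 ∧ (x.2 : ℕ) = 0 then p ^ k else 1) := by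
  rcases Nat.eq_zero_or_pos k with rfl | hk
  · exact ⟨1, 1, by simp, by simp, Matrix.ext fun i => i.1.elim0⟩
  set x₀ : Fin k × Fin p.natDegree := (⟨0, hk⟩, ⟨0, hn⟩) with hx₀
  set B := (jacobsonBlock p k).charmatrix with hB
  set d : Fin k × Fin p.natDegree → K[X] :=
    fun x => if (x.1 : ℕ) = 0 ∧ (x.2 : ℕ) = 0 then p ^ k else 1 with hd
  have hd0 : d x₀ = p ^ k := by simp [hd, hx₀]
  have hd1 : ∀ x, x ≠ x₀ → d x = 1 := by
    intro x hx
    refine if_neg fun h => hx ?_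
    exact Prod.ext (Fin.ext h.1) (Fin.ext h.2)
  set Q := (1 : Matrix (Fin k × Fin p.natDegree) (Fin k × Fin p.natDegree) K[X]).updateCol x₀
    (powerVector p k) with hQ
  set Z := B.updateCol x₀ (fun x => C (lastVector p k x)) with hZ
  have hBQ : B * Q = Z * diagonal d := by
    rw [hQ, mul_updateCol, Matrix.mul_one, charmatrix_jacobsonBlock_mulVec_powerVector hp]
    refine Matrix.ext fun i j => ?_
    rw [mul_diagonal]
    by_cases hj : j = x₀
    · subst hj; rw [updateCol_self, hZ, updateCol_self, hd0, mul_comm]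
    · rw [updateCol_ne hj, hZ, updateCol_ne hj, hd1 j hj, mul_one]
  have hQdet : Q.det = 1 := by
    rw [hQ, ← cramer_apply, cramer_one]; simp [powerVector, hx₀]
  have hDdet : (diagonal d).det = p ^ k := by
    rw [det_diagonal, Finset.prod_eq_single x₀ (fun x _ hx => hd1 x hx) (by simp), hd0]
  have hdet := congrArg det hBQ
  rw [det_mul, det_mul, hQdet, mul_one, hDdet] at hdet
  -- pᵏ divides the characteristic polynomial; both are monic of degree k deg p, so the cofactor det
  -- Z is 1.
  have hpoly : p ^ k = (jacobsonBlock p k).charpoly := by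
    refine Eq.symm <| eq_of_monic_of_dvd_of_natDegree_le (hp.pow k) (charpoly_monic _)
      ⟨Z.det, by rw [mul_comm]; exact hdet⟩ ?_
    rw [charpoly_natDegree_eq_dim, hp.natDegree_pow]; simp
  have hZdet : Z.det = 1 := by
    have h : B.det = p ^ k := hpoly.symm
    rw [h] at hdet
    exact mul_right_cancel₀ (hp.pow k).ne_zero (by rw [← hdet, one_mul])
  refine ⟨Z, Q⁻¹, by simp [hZdet], isUnit_nonsing_inv_det _ (by simp [hQdet]), ?_⟩
  rw [← hBQ, Matrix.mul_assoc, mul_nonsing_inv _ (by simp [hQdet]), Matrix.mul_one]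

theorem UnimodularEquiv.blockDiagonal' {R : Type*} [CommRing R] {ι : Type*} [Fintype ι]
    [DecidableEq ι] {n : ι → Type*} [∀ i, Fintype (n i)] [∀ i, DecidableEq (n i)]
    {M N : ∀ i, Matrix (n i) (n i) R} (h : ∀ i, UnimodularEquiv (M i) (N i)) :
    UnimodularEquiv (blockDiagonal' M) (blockDiagonal' N) := by
  choose U V hU hV hM using h
  have hdet : ∀ W : ∀ i, Matrix (n i) (n i) R, (∀ i, IsUnit (W i).det) →
      IsUnit (Matrix.blockDiagonal' W).det := by
    intro W hW
    refine isUnit_det_of_right_inverse (B := Matrix.blockDiagonal' fun i => (W i)⁻¹) ?_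
    rw [← blockDiagonal'_mul]
    simp only [fun i => mul_nonsing_inv (W i) (hW i)]
    exact blockDiagonal'_one
  refine ⟨Matrix.blockDiagonal' U, Matrix.blockDiagonal' V, hdet U hU, hdet V hV, ?_⟩
  rw [← blockDiagonal'_mul, ← blockDiagonal'_mul]
  exact congrArg _ (funext hM)

theorem unimodularEquiv_charmatrix_jacobsonDiag {ι : Type*} [Fintype ι] [DecidableEq ι]
    {p : ι → K[X]} (k : ι → ℕ) (hp : ∀ i, (p i).Monic) (hn : ∀ i, 0 < (p i).natDegree) :
    UnimodularEquiv (jacobsonDiag p k).charmatrix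
      (diagonal fun z => if (z.2.1 : ℕ) = 0 ∧ (z.2.2 : ℕ) = 0 then p z.1 ^ k z.1 else 1) := by
  rw [jacobsonDiag, charmatrix_blockDiagonal']
  have := UnimodularEquiv.blockDiagonal' fun i =>
    unimodularEquiv_charmatrix_jacobsonBlock (hp i) (hn i) (k i)
  rwa [blockDiagonal'_diagonal] at this

theorem isJacobsonNormalForm_of_similar {ℓ : ℕ} {A : Matrix (Fin ℓ) (Fin ℓ) K} {ι : Type*}
    [Fintype ι] [DecidableEq ι] {p : ι → K[X]} {k : ι → ℕ} (hp : ∀ i, (p i).Monic)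
    (hirr : ∀ i, Irreducible (p i))
    {H : Matrix (Fin ℓ) (Σ i, Fin (k i) × Fin (p i).natDegree) K}
    {G : Matrix (Σ i, Fin (k i) × Fin (p i).natDegree) (Fin ℓ) K}
    (hHG : H * G = 1) (hGH : G * H = 1) (hA : A = H * jacobsonDiag p k * G) :
    IsJacobsonNormalForm A p k := by
  refine ⟨fun i => ⟨hp i, hirr i⟩, ?_⟩
  have hcard : Fintype.card (Σ i, Fin (k i) × Fin (p i).natDegree) = Fintype.card (Fin ℓ) :=
    square_of_invertible G H hGH hHG
  let e : Fin ℓ ≃ (Σ i, Fin (k i) × Fin (p i).natDegree) := (Fintype.equivOfCardEq hcard).symm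
  let f : (Σ i, Fin (k i) × Fin (p i).natDegree) → K[X] :=
    fun z => if (z.2.1 : ℕ) = 0 ∧ (z.2.2 : ℕ) = 0 then p z.1 ^ k z.1 else 1
  have h1 : UnimodularEquiv A.charmatrix ((jacobsonDiag p k).charmatrix.submatrix e e) := by
    have hHG' : H.map C * G.map C = (1 : Matrix (Fin ℓ) (Fin ℓ) K[X]) := by
      rw [← Matrix.map_mul, hHG, Matrix.map_one _ (map_zero _) (map_one _)]
    refine ⟨(H.map C).submatrix id e, (G.map C).submatrix e id, ?_, ?_, ?_⟩
    · refine isUnit_det_of_right_inverse (B := (G.map C).submatrix e id) ?_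
      rw [submatrix_mul_equiv, hHG', submatrix_id_id]
    · refine isUnit_det_of_left_inverse (B := (H.map C).submatrix id e) ?_
      rw [submatrix_mul_equiv, hHG', submatrix_id_id]
    · rw [submatrix_mul_equiv, submatrix_mul_equiv, submatrix_id_id, charmatrix, charmatrix,
        Matrix.mul_sub, Matrix.sub_mul]
      congr 1
      · have : H.map C * scalar (Σ i, Fin (k i) × Fin (p i).natDegree) (X : K[X]) =
            scalar (Fin ℓ) (X : K[X]) * H.map C := by
          refine Matrix.ext fun i j => ?_
          rw [scalar_apply, scalar_apply, mul_diagonal, diagonal_mul, mul_comm]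
        rw [this, Matrix.mul_assoc, hHG', Matrix.mul_one]
      · rw [RingHom.mapMatrix_apply, RingHom.mapMatrix_apply, hA, Matrix.map_mul, Matrix.map_mul]
  have h2 : UnimodularEquiv A.charmatrix (diagonal (f ∘ e)) := by
    have := (unimodularEquiv_charmatrix_jacobsonDiag k hp fun i => (hirr i).natDegree_pos).submatrix e
    rw [submatrix_diagonal_equiv] at this
    exact h1.trans this
  obtain ⟨d, hd, hmonic, hchain, hsum⟩ := exists_divisibility_chain (f ∘ e) (by
    intro i
    simp only [Function.comp, f]
    split_ifs
    · exact pow_ne_zero _ (hp _).ne_zero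
    · exact one_ne_zero)
  obtain ⟨U, V, hU, hV, hUV⟩ := h2.trans hd
  refine ⟨d, U, V, hU, hV, hUV, hmonic, hchain, ?_⟩
  rw [← hsum, ← Equiv.sum_comp e.symm]
  simp only [Function.comp, Equiv.apply_symm_apply]
  -- Each nonempty block contributes one non-unit diagonal entry pᵏ; a block with exponent 0 has no
  -- indices and is absent from the filtered list too.
  rw [Fintype.sum_sigma, ← sum_singleton_eq_map, Finset.sum_filter]
  refine Finset.sum_congr rfl fun x _ => ?_
  split_ifs with hk
  · rw [Finset.sum_eq_single (⟨0, hk⟩, ⟨0, (hirr x).natDegree_pos⟩)]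
    · simp only [f, and_self, if_true]
      rw [primePowerFactors_pow (hirr x) (hp x) hk]
    · intro z _ hz
      have : ¬((z.1 : ℕ) = 0 ∧ (z.2 : ℕ) = 0) :=
        fun h => hz (Prod.ext (Fin.ext h.1) (Fin.ext h.2))
      simp only [f, this, if_false, primePowerFactors_one]
    · simp
  · exact (Finset.sum_eq_zero fun z _ => absurd z.1.pos hk).symm

/-! ### Existence of the data of the procedure -/

theorem exists_prime_factorization {d : K[X]} (hd : d.Monic) :
    ∃ (m : ℕ) (p : Fin m → K[X]) (e : Fin m → ℕ), (∀ μ, (p μ).Monic) ∧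
      (∀ μ, Irreducible (p μ)) ∧ Function.Injective p ∧ (∀ μ, 0 < e μ) ∧ d = ∏ μ, p μ ^ e μ := by
  classical
  set s := (normalizedFactors d).toFinset with hs
  have hmem : ∀ x : s, (x : K[X]) ∈ normalizedFactors d := fun x => Multiset.mem_toFinset.1 x.2
  refine ⟨s.card, fun μ => s.equivFin.symm μ, fun μ => (normalizedFactors d).count
    (s.equivFin.symm μ : K[X]), fun μ => ?_, fun μ => ?_, ?_, fun μ => ?_, ?_⟩
  · have h := hmem (s.equivFin.symm μ)
    have h0 := (irreducible_of_normalized_factor _ h).ne_zero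
    change (s.equivFin.symm μ : K[X]).Monic
    rw [← normalize_normalized_factor _ h]
    exact monic_normalize h0
  · exact irreducible_of_normalized_factor _ (hmem _)
  · exact Subtype.val_injective.comp s.equivFin.symm.injective
  · exact Multiset.count_pos.2 (hmem _)
  · rw [Equiv.prod_comp s.equivFin.symm
      (fun x : s => (x : K[X]) ^ (normalizedFactors d).count (x : K[X])),
      Finset.prod_coe_sort s (fun x => x ^ (normalizedFactors d).count x), hs,
      ← Finset.prod_multiset_count, prod_normalizedFactors_eq hd.ne_zero,
      hd.normalize_eq_self]

/-- Polynomials that are idempotents of the partial fraction decomposition modulo a product of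
pairwise coprime factors. -/
theorem exists_idempotents {m : ℕ} (s : Fin m → K[X])
    (hs : Pairwise fun μ ν => IsCoprime (s μ) (s ν)) :
    ∃ ε : Fin m → K[X], (∏ μ, s μ) ∣ 1 - ∑ μ, ε μ ∧ (∀ μ, (∏ μ, s μ) ∣ s μ * ε μ) ∧
      ∀ μ, (∏ μ, s μ) ∣ ε μ * ε μ - ε μ := by
  classical
  rcases Nat.eq_zero_or_pos m with rfl | hm
  · exact ⟨0, by simp, fun μ => μ.elim0, fun μ => μ.elim0⟩
  have : Nonempty (Fin m) := ⟨⟨0, hm⟩⟩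
  obtain ⟨c, hc⟩ := exists_sum_eq_one_iff_pairwise_coprime'.2 hs
  have h2 : ∀ μ, (∏ μ, s μ) ∣ s μ * (c μ * ∏ ν ∈ {μ}ᶜ, s ν) := by
    intro μ
    rw [Fintype.prod_eq_mul_prod_compl μ]
    exact ⟨c μ, by ring⟩
  refine ⟨fun μ => c μ * ∏ ν ∈ {μ}ᶜ, s ν, by rw [hc, sub_self]; exact dvd_zero _, h2,
    fun μ => ?_⟩
  -- Since the ε's sum to 1, ε_μ² - ε_μ is minus the sum of the products ε_μ ε_κ with κ ≠ μ, and
  -- such a product contains every factor of ∏ s.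
  have h3 : (c μ * ∏ ν ∈ {μ}ᶜ, s ν) * (c μ * ∏ ν ∈ {μ}ᶜ, s ν) - c μ * ∏ ν ∈ {μ}ᶜ, s ν =
      - ∑ κ ∈ {μ}ᶜ, (c μ * ∏ ν ∈ {μ}ᶜ, s ν) * (c κ * ∏ ν ∈ {κ}ᶜ, s ν) := by
    rw [Fintype.sum_eq_add_sum_compl μ] at hc
    rw [← Finset.mul_sum]
    linear_combination (c μ * ∏ ν ∈ {μ}ᶜ, s ν) * hc
  rw [h3, dvd_neg]
  refine Finset.dvd_sum fun κ hκ => ?_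
  refine (h2 κ).trans (mul_dvd_mul ?_ dvd_rfl)
  exact (Finset.dvd_prod_of_mem s hκ).mul_left _

/-! ### Denominators of the resolvent and annihilating polynomials -/

section ResolventDenominators

variable {n : Type*} [Fintype n] [DecidableEq n] (A : Matrix n n K)

/-- The polynomial matrix q(s)I - q(A) is divisible by sI - A; Y is the quotient. -/
theorem toRat_smul_matResolvent (q : K[X]) : ∃ Y : Matrix n n K[X],
    toRat q • matResolvent A = (aeval A q).map RatFunc.C * matResolvent A + Y.map toRat := by
  induction q using Polynomial.induction_on with
  | C a =>
    refine ⟨0, ?_⟩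
    have h : (algebraMap K (Matrix n n K) a).map RatFunc.C =
        RatFunc.C a • (1 : Matrix n n (RatFunc K)) := by
      refine Matrix.ext fun i j => ?_
      by_cases hij : i = j <;> simp [algebraMap_matrix_apply, hij]
    rw [aeval_C, toRat_C, Matrix.map_zero _ (map_zero _), add_zero, h, Matrix.smul_mul,
      Matrix.one_mul]
  | add f g hf hg =>
    obtain ⟨Y, hY⟩ := hf
    obtain ⟨Z, hZ⟩ := hg
    refine ⟨Y + Z, ?_⟩
    rw [toRat_add, add_smul, hY, hZ, map_add, Matrix.map_add RatFunc.C (map_add _),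
      Matrix.map_add toRat toRat_add, Matrix.add_mul]
    abel
  | monomial k a ih =>
    obtain ⟨Y, hY⟩ := ih
    have h0 : (C a * X ^ (k + 1) : K[X]) = X * (C a * X ^ k) := by ring
    generalize (C a * X ^ k : K[X]) = q at hY h0
    refine ⟨((aeval A q).map C : Matrix n n K[X]) + (X : K[X]) • Y, ?_⟩
    have h1 : (RatFunc.X : RatFunc K) • matResolvent A = A.map RatFunc.C * matResolvent A + 1 := by
      rw [const_mul_matResolvent, sub_add_cancel]
    have h2 : aeval A (X * q) = aeval A q * A := by rw [mul_comm, map_mul, aeval_X]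
    rw [h0, toRat_mul, toRat_X, mul_smul, hY, smul_add, ← Matrix.mul_smul, h1, h2, Matrix.map_mul,
      Matrix.mul_add, Matrix.mul_one, Matrix.mul_assoc, add_assoc]
    congr 2
    refine Matrix.ext fun i j => ?_
    simp [toRat]

theorem denom_dvd_of_aeval_eq_zero {q : K[X]} (hq0 : q ≠ 0) (hq : aeval A q = 0) (i j : n) :
    (matResolvent A i j).denom ∣ q := by
  obtain ⟨Y, hY⟩ := toRat_smul_matResolvent A q
  rw [hq, Matrix.map_zero _ (map_zero _), Matrix.zero_mul, zero_add] at hY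
  refine (RatFunc.denom_dvd hq0).2 ⟨Y i j, ?_⟩
  rw [eq_div_iff (toRat_ne_zero hq0), mul_comm]
  exact congrFun (congrFun hY i) j

/-- If q(s) clears the denominators, q(A)(sI - A)⁻¹ is both polynomial and strictly proper, hence
zero, and the resolvent is invertible. With `denom_dvd_of_aeval_eq_zero` this identifies the least
common denominator as the minimal polynomial. -/
theorem aeval_eq_zero_of_denom_dvd {q : K[X]} (hq : ∀ i j, (matResolvent A i j).denom ∣ q) :
    aeval A q = 0 := by
  obtain ⟨Y, hY⟩ := toRat_smul_matResolvent A q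
  choose c hc using hq
  have h1 : (aeval A q).map RatFunc.C * matResolvent A = 0 := by
    refine Matrix.ext fun i j => ?_
    have hsp := isStrictlyProper_const_mul (aeval A q) (isStrictlyProper_matResolvent A) i j
    have hpoly : ((aeval A q).map RatFunc.C * matResolvent A) i j =
        toRat ((matResolvent A i j).num * c i j - Y i j) := by
      have h2 := congrFun (congrFun hY i) j
      rw [Matrix.smul_apply, Matrix.add_apply, Matrix.map_apply, smul_eq_mul] at h2
      rw [toRat_sub, toRat_mul, ← sub_eq_iff_eq_add.2 h2]
      congr 1
      have hd := toRat_ne_zero (matResolvent A i j).denom_ne_zero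
      have h3 : toRat (matResolvent A i j).num =
          matResolvent A i j * toRat (matResolvent A i j).denom :=
        (div_eq_iff hd).1 (RatFunc.num_div_denom (matResolvent A i j))
      calc toRat q * matResolvent A i j
          = toRat ((matResolvent A i j).denom * c i j) * matResolvent A i j := by rw [← hc]
        _ = toRat (matResolvent A i j).num * toRat (c i j) := by rw [toRat_mul, h3]; ring
    rw [hpoly] at hsp ⊢
    rw [hsp.eq_zero_of_toRat, toRat_zero]; rfl
  have h2 := congrArg (fun M => M * A.charmatrix.map toRat) h1
  simp only [Matrix.mul_assoc, matResolvent_mul_charmatrix, Matrix.mul_one, Matrix.zero_mul] at h2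
  refine Matrix.ext fun i j => RatFunc.C_injective ?_
  rw [Matrix.zero_apply, map_zero]
  exact congrFun (congrFun h2 i) j

end ResolventDenominators

theorem exists_initial_segment {n : ℕ} {κ : Fin n → ℕ} (hκ : Antitone κ) :
    ∃ r ≤ n, ∀ i : Fin n, (i : ℕ) < r ↔ 0 < κ i := by
  classical
  have h : ∃ r : ℕ, ∀ i : Fin n, r ≤ (i : ℕ) → κ i = 0 :=
    ⟨n, fun i hi => absurd i.2 (not_lt.2 hi)⟩
  refine ⟨Nat.find h, Nat.find_min' h fun i hi => absurd i.2 (not_lt.2 hi), fun i => ⟨fun hi => ?_,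
    fun hi => ?_⟩⟩
  · have := Nat.find_min h hi
    push Not at this
    obtain ⟨j, hij, hj⟩ := this
    exact (Nat.pos_of_ne_zero hj).trans_le (hκ hij)
  · by_contra hlt
    exact hi.ne' (Nat.find_spec h i (not_lt.1 hlt))

/-- A rational matrix with denominators dividing `pᵉ` which has a polynomial generalized inverse
has a Smith-McMillan decomposition. -/
theorem exists_smithMcMillan {n : ℕ} {p : K[X]} (hp : Irreducible p) {e : ℕ}
    {T : Matrix (Fin n) (Fin n) (RatFunc K)} {N B : Matrix (Fin n) (Fin n) K[X]}
    (hN : toRat (p ^ e) • T = N.map toRat) (hB : T * B.map toRat * T = T) :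
    Nonempty (SmithMcMillan p T) := by
  classical
  obtain ⟨D, U, V, hU, hV, hD⟩ := exists_unimodularEquiv_diagonal n N
  have hpe := toRat_ne_zero (pow_ne_zero e hp.ne_zero)
  have hNB : N * B * N = p ^ e • N := by
    have h : (N * B * N).map toRat = (p ^ e • N).map toRat := by
      have e1 : (N * B * N).map toRat = N.map toRat * B.map toRat * N.map toRat := by
        simp only [Matrix.map_mul]
      have e2 : (p ^ e • N).map toRat = toRat (p ^ e) • N.map toRat := by
        refine Matrix.ext fun i j => ?_
        simp [toRat]
      rw [e1, e2, ← hN, Matrix.smul_mul, Matrix.smul_mul, Matrix.mul_smul, hB]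
    exact Matrix.map_injective toRat_injective h
  have hdiag : diagonal D * (V * B * U) * diagonal D = p ^ e • diagonal D := by
    have e1 : diagonal D = U⁻¹ * N * V⁻¹ := by
      rw [hD, ← Matrix.mul_assoc, ← Matrix.mul_assoc, nonsing_inv_mul _ hU, Matrix.one_mul,
        Matrix.mul_assoc, mul_nonsing_inv _ hV, Matrix.mul_one]
    calc diagonal D * (V * B * U) * diagonal D
        = U⁻¹ * (U * diagonal D * V * B * (U * diagonal D * V)) * V⁻¹ := by
          simp only [Matrix.mul_assoc, mul_nonsing_inv _ hV, Matrix.mul_one]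
          rw [← Matrix.mul_assoc U⁻¹ U, nonsing_inv_mul _ hU, Matrix.one_mul]
      _ = p ^ e • diagonal D := by
          rw [← hD, hNB, Matrix.mul_smul, Matrix.smul_mul, ← e1]
  -- TBT = T has become D X D = pᵉ D; its diagonal entries read D_i x D_i = pᵉ D_i.
  have hdvd : ∀ i, D i ≠ 0 → D i ∣ p ^ e := by
    intro i hi
    have h := congrFun (congrFun hdiag i) i
    rw [mul_diagonal, diagonal_mul, Matrix.smul_apply, diagonal_apply_eq, smul_eq_mul] at h
    exact ⟨_, (mul_right_cancel₀ hi h).symm⟩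
  -- The exponent is encoded with a shift: κ = 0 marks a zero entry, κ = k + 1 an entry w / pᵏ.
  -- Sorting by decreasing κ then puts the zero entries last, behind those with k = 0. The units w
  -- go into U, so every numerator a_i is 1.
  have hw : ∀ i, ∃ (κ : ℕ) (w : K[X]), IsUnit w ∧
      toRat (D i) / toRat (p ^ e) = if κ = 0 then 0 else toRat w * (1 / toRat (p ^ (κ - 1))) := by
    intro i
    by_cases hi : D i = 0
    · exact ⟨0, 1, isUnit_one, by simp [hi, toRat_zero]⟩
    · obtain ⟨m, hm, hass⟩ := (dvd_prime_pow hp.prime e).1 (hdvd i hi)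
      obtain ⟨w, hw⟩ := hass.symm
      refine ⟨e - m + 1, w, w.isUnit, ?_⟩
      have h1 := toRat_ne_zero (pow_ne_zero (e - m) hp.ne_zero)
      rw [if_neg (Nat.succ_ne_zero _), Nat.add_sub_cancel, ← hw, mul_one_div,
        div_eq_div_iff hpe h1, ← toRat_mul, ← toRat_mul]
      congr 1
      calc p ^ m * w * p ^ (e - m) = w * (p ^ m * p ^ (e - m)) := by ring
        _ = w * p ^ e := by rw [← pow_add, Nat.add_sub_cancel' hm]
  choose κ w hwu hκ using hw
  let σ : Equiv.Perm (Fin n) := Tuple.sort fun i => OrderDual.toDual (κ i)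
  have hanti : Antitone (κ ∘ σ) := fun i j hij =>
    Tuple.monotone_sort (fun i => OrderDual.toDual (κ i)) hij
  obtain ⟨r, hr, hrκ⟩ := exists_initial_segment hanti
  refine ⟨{
    r := r
    r_le_rows := hr
    r_le_cols := hr
    a := fun _ => 1
    k := fun l => κ (σ (Fin.castLE hr l)) - 1
    U := (U * diagonal w).submatrix id σ
    V := (V.submatrix σ id)ᵀ
    k_antitone := fun i j hij => Nat.sub_le_sub_right (hanti hij) 1
    coprime := fun _ => isCoprime_one_right
    dvd_chain := fun _ _ _ => dvd_rfl
    unimodular_U := ?_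
    unimodular_V := ?_
    factorization := ?_ }⟩
  · rw [det_permute', det_mul, det_diagonal]
    refine IsUnit.mul ?_ (hU.mul (IsUnit.prod_univ_iff.2 hwu))
    exact (Equiv.Perm.sign σ).isUnit.map (Int.castRingHom K[X])
  · rw [det_transpose, det_permute]
    refine IsUnit.mul ?_ hV
    exact (Equiv.Perm.sign σ).isUnit.map (Int.castRingHom K[X])
  · set δ : Fin n → RatFunc K := fun i => if κ i = 0 then 0 else 1 / toRat (p ^ (κ i - 1)) with hδ
    have e1 : (Matrix.of fun (i : Fin n) (j : Fin n) =>
        if h : (i : ℕ) = j ∧ (i : ℕ) < r then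
          toRat (1 : K[X]) / toRat (p ^ (κ (σ (Fin.castLE hr ⟨i, h.2⟩)) - 1)) else 0) =
        (diagonal δ).submatrix σ σ := by
      rw [submatrix_diagonal_equiv]
      refine Matrix.ext fun i j => ?_
      rw [of_apply, diagonal_apply]
      by_cases hij : i = j
      · subst hij
        rw [if_pos rfl]
        by_cases hi : (i : ℕ) < r
        · have h0 : κ (σ i) ≠ 0 := ((hrκ i).1 hi).ne'
          rw [dif_pos ⟨rfl, hi⟩, toRat_one]
          simp only [hδ, Function.comp, h0, if_false]
          rfl
        · have h0 : κ (σ i) = 0 := by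
            by_contra h
            exact hi ((hrκ i).2 (Nat.pos_of_ne_zero h))
          rw [dif_neg fun h => hi h.2]
          simp only [hδ, Function.comp, h0, if_true]
      · rw [dif_neg fun h => hij (Fin.ext h.1), if_neg hij]
    have e2 : T = (U * diagonal w).map toRat * diagonal δ * V.map toRat := by
      have h1 : T = (toRat (p ^ e))⁻¹ • N.map toRat := by
        rw [← hN, smul_smul, inv_mul_cancel₀ hpe, one_smul]
      have h2 : N.map toRat = U.map toRat * (diagonal D).map toRat * V.map toRat := by
        rw [hD]; simp only [Matrix.map_mul]
      have h3 : (toRat (p ^ e))⁻¹ • (diagonal D).map toRat = (diagonal w).map toRat * diagonal δ := by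
        rw [diagonal_map (map_zero _), diagonal_map (map_zero _), diagonal_mul_diagonal,
          ← diagonal_smul]
        congr 1
        ext i
        have := hκ i
        simp only [Pi.smul_apply, smul_eq_mul, hδ]
        rw [mul_ite, mul_zero, ← this, div_eq_inv_mul]
      have h4 : (U * diagonal w).map toRat = U.map toRat * (diagonal w).map toRat := by
        simp only [Matrix.map_mul]
      rw [h1, h2, ← Matrix.smul_mul, ← Matrix.mul_smul, h3, h4]
      simp only [Matrix.mul_assoc]
    rw [e1, transpose_map, transpose_transpose, ← submatrix_map, ← submatrix_map, submatrix_mul_equiv,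
      submatrix_mul_equiv, submatrix_id_id]
    exact e2

theorem exists_strictlyProper_numerator {p : K[X]} (hp : p.Monic) (a : K[X]) (k : ℕ) :
    ∃ b : K[X], IsStrictlyProperPart (toRat a / toRat (p ^ k)) (toRat b / toRat (p ^ k)) := by
  have hpk := toRat_ne_zero (hp.pow k).ne_zero
  refine ⟨a %ₘ p ^ k, ⟨a %ₘ p ^ k, p ^ k, (hp.pow k).ne_zero,
    degree_modByMonic_lt _ (hp.pow k), rfl⟩, a /ₘ p ^ k, ?_⟩
  have h : toRat a = toRat (a %ₘ p ^ k) + toRat (p ^ k) * toRat (a /ₘ p ^ k) := by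
    rw [← toRat_mul, ← toRat_add, modByMonic_add_div]
  rw [h, add_div, mul_div_cancel_left₀ _ hpk]

theorem nonempty_procedure {ℓ : ℕ} (A : Matrix (Fin ℓ) (Fin ℓ) K) :
    Nonempty (Procedure (matResolvent A)) := by
  have hint : IsIntegral K A := Algebra.IsIntegral.isIntegral A
  have hmonic := minpoly.monic hint
  obtain ⟨m, p, e, hpm, hpi, hpinj, hpe, hd⟩ := exists_prime_factorization hmonic
  have hcop : Pairwise fun μ ν => IsCoprime (p μ ^ e μ) (p ν ^ e ν) := by
    intro μ ν h
    refine IsCoprime.pow ?_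
    rw [(hpi μ).coprime_iff_not_dvd]
    intro hd
    exact h (hpinj (eq_of_monic_of_associated (hpm μ) (hpm ν)
      ((hpi μ).associated_of_dvd (hpi ν) hd)))
  obtain ⟨ε, hε1, hε2, hε3⟩ := exists_idempotents (fun μ => p μ ^ e μ) hcop
  rw [← hd] at hε1
  simp only [← hd] at hε2 hε3
  have hzero : ∀ {q : K[X]}, minpoly K A ∣ q → aeval A q = 0 := fun h =>
    aeval_eq_zero_of_dvd_aeval_eq_zero h (minpoly.aeval K A)
  -- These are the projections onto the primary components of A; multiplying the resolvent by them
  -- yields its partial fractions.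
  let E : Fin m → Matrix (Fin ℓ) (Fin ℓ) K := fun μ => aeval A (ε μ)
  let part : Fin m → Matrix (Fin ℓ) (Fin ℓ) (RatFunc K) :=
    fun μ => (E μ).map RatFunc.C * matResolvent A
  have hE1 : ∑ μ, E μ = 1 := by
    have h := hzero hε1
    rw [map_sub, map_one, map_sum, sub_eq_zero] at h
    exact h.symm
  have hE3 : ∀ μ, E μ * E μ = E μ := by
    intro μ
    have h := hzero (hε3 μ)
    rw [map_sub, map_mul, sub_eq_zero] at h
    exact h
  have hsum : matResolvent A = ∑ μ, part μ := by
    have h : (∑ μ, (E μ).map RatFunc.C : Matrix (Fin ℓ) (Fin ℓ) (RatFunc K)) = 1 := by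
      have := congrArg (RatFunc.C : K →+* RatFunc K).mapMatrix hE1
      rw [map_sum, map_one] at this
      exact this
    rw [← Finset.sum_mul, h, Matrix.one_mul]
  have hN : ∀ μ, ∃ N : Matrix (Fin ℓ) (Fin ℓ) K[X], toRat (p μ ^ e μ) • part μ = N.map toRat := by
    intro μ
    obtain ⟨Y, hY⟩ := toRat_smul_matResolvent A (p μ ^ e μ)
    refine ⟨(E μ).map C * Y, ?_⟩
    have h0 : E μ * aeval A (p μ ^ e μ) = 0 := by
      rw [← map_mul, mul_comm]; exact hzero (hε2 μ)
    have h1 : ((E μ).map C * Y).map toRat = (E μ).map RatFunc.C * Y.map toRat := by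
      have h2 : ((E μ).map C).map toRat = (E μ).map RatFunc.C := by
        refine Matrix.ext fun i j => ?_
        simp [toRat]
      rw [← h2]
      simp only [Matrix.map_mul]
    rw [h1, ← Matrix.mul_smul, hY, Matrix.mul_add, ← Matrix.mul_assoc, ← Matrix.map_mul, h0,
      Matrix.map_zero _ (map_zero _), Matrix.zero_mul, zero_add]
  -- Idempotence of E makes sI - A a generalized inverse of every part, as `exists_smithMcMillan`
  -- requires.
  have hB : ∀ μ, part μ * A.charmatrix.map toRat * part μ = part μ := by
    intro μ
    simp only [part]
    rw [Matrix.mul_assoc _ (matResolvent A), matResolvent_mul_charmatrix, Matrix.mul_one,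
      ← Matrix.mul_assoc, ← Matrix.map_mul, hE3]
  choose N hN using hN
  have S : ∀ μ, SmithMcMillan (p μ) (part μ) := fun μ =>
    (exists_smithMcMillan (hpi μ) (hN μ) (hB μ)).some
  choose at_ hat using fun μ (i : Fin (S μ).r) =>
    exists_strictlyProper_numerator (hpm μ) ((S μ).a i) ((S μ).k i)
  exact ⟨{
    m := m
    p := p
    e := e
    p_monic := hpm
    p_irreducible := hpi
    p_injective := hpinj
    e_pos := hpe
    lcd := by
      rw [← hd]
      exact ⟨hmonic, denom_dvd_of_aeval_eq_zero A hmonic.ne_zero (minpoly.aeval K A),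
        fun d' h => minpoly.dvd K A (aeval_eq_zero_of_denom_dvd A h)⟩
    part := part
    part_sum := hsum
    part_proper := fun μ => isStrictlyProper_const_mul (E μ) (isStrictlyProper_matResolvent A)
    part_denom := fun μ i j => ⟨e μ, (RatFunc.denom_dvd ((hpm μ).pow _).ne_zero).2 ⟨N μ i j, by
      rw [eq_div_iff (toRat_ne_zero ((hpm μ).pow _).ne_zero), mul_comm]
      exact congrFun (congrFun (hN μ) i) j⟩⟩
    smith := S
    atilde := at_
    atilde_spec := hat }⟩

end JacobsonRealization

theorem mainTheorem3 {K : Type*} [Field K] {ℓ : ℕ} (A : Matrix (Fin ℓ) (Fin ℓ) K) :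
    Nonempty (JacobsonRealization.Procedure (JacobsonRealization.matResolvent A)) ∧
    ∀ P : JacobsonRealization.Procedure (JacobsonRealization.matResolvent A),
      JacobsonRealization.matResolvent A =
        P.H.map RatFunc.C * JacobsonRealization.matResolvent P.F * P.G.map RatFunc.C ∧
      Fintype.card P.State = ℓ ∧
      P.H * P.G = 1 ∧ P.G * P.H = 1 ∧
      A = P.H * P.F * P.G ∧
      P.G * A * P.H = P.F ∧
      JacobsonRealization.IsJacobsonNormalForm A P.prime P.exponent := by
  refine ⟨JacobsonRealization.nonempty_procedure A, fun P => ?_⟩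
  obtain ⟨hAH, hHG⟩ := P.mul_H_sub
  have hGH := P.G_mul_H
  have hA : A = P.H * P.F * P.G := by rw [← hAH, Matrix.mul_assoc, hHG, Matrix.mul_one]
  refine ⟨P.realization, ?_, hHG, hGH, hA, ?_, ?_⟩
  · simpa using Matrix.square_of_invertible P.G P.H hGH hHG
  · rw [Matrix.mul_assoc, hAH, ← Matrix.mul_assoc, hGH, Matrix.one_mul]
  · exact JacobsonRealization.isJacobsonNormalForm_of_similar P.prime_monic
      (fun x => P.p_irreducible x.1) hHG hGH hA
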